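/- Let $0<H<\frac13$ and $T>0$. There is a constant $C>0$, depending only on $H$ and $T$, such that the following holds. Let $B=(B_t)_{t\in[0,T]}$ be a fractional Brownian motion with Hurst parameter $H$ on a probability space $(\Omega,\mathcal F,P)$, i.e. a centered Gaussian process with a.s. continuous paths and $E[B_tB_s]=\frac12\left(t^{2H}+s^{2H}-|t-s|^{2H}\right)$. Let $b:[0,T]\times\mathbb R\to\mathbb R$ be bounded and measurable, with $\|b\|_\infty=\sup_{[0,T]\times\mathbb R}|b|$. Then for all $t\in[0,T]$ and $y\in\mathbb R$ the random variable $$\Lambda^b(t,y)=(2\pi)^{-1}\int_{\mathbb R}\int_0^t b(s,y)\,iu\,e^{-iu(B_s-y)}\,ds\,du$$ is well defined and has moments of all orders, in the following sense: the truncated variables $$\Lambda^b_K(t,y)=(2\pi)^{-1}\int_{-K}^{K}\int_0^t b(s,y)\,iu\,e^{-iu(B_s-y)}\,ds\,du$$ belong to $L^p(\Omega)$ for every finite $p$, and there is a $P$-a.s. unique real random variable $\Lambda^b(t,y)$, belonging to $L^p(\Omega)$ for every finite $p$, such that $\Lambda^b_K(t,y)\to\Lambda^b(t,y)$ in $L^p(\Omega)$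 as $K\to\infty$ for every finite $p$. Moreover, for every even integer $m\ge 0$, $$E\left[|\Lambda^b(t,y)|^m\right]\le\frac{C^m\,\|b\|_\infty^m\,m!}{\Gamma\left(m(1-3H)+1\right)}.$$ -/

import Mathlib

open MeasureTheory ProbabilityTheory Filter Topology
open scoped NNReal ENNReal Nat

/-- `B`, restricted to the time interval `[0, T]`, is a fractional Brownian motion with Hurst
parameter `H` under `P`: a centered Gaussian process with covariance
`(t ^ (2H) + s ^ (2H) - |t - s| ^ (2H)) / 2` and almost surely continuous paths. -/
structure IsFractionalBrownianMotion {Ω : Type*} [MeasurableSpace Ω] (P : Measure Ω)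
    (H T : ℝ) (B : ℝ → Ω → ℝ) : Prop where
  gaussian : IsGaussianProcess (fun s : Set.Icc (0 : ℝ) T => B s) P
  centered : ∀ t ∈ Set.Icc (0 : ℝ) T, ∫ ω, B t ω ∂P = 0
  covariance : ∀ t ∈ Set.Icc (0 : ℝ) T, ∀ s ∈ Set.Icc (0 : ℝ) T,
    ∫ ω, B t ω * B s ω ∂P = (t ^ (2 * H) + s ^ (2 * H) - |t - s| ^ (2 * H)) / 2
  continuous_paths : ∀ᵐ ω ∂P, ContinuousOn (fun t => B t ω) (Set.Icc (0 : ℝ) T)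

/-- The supremum norm of `b` on `[0, T] × ℝ` (meaningful for bounded `b`). -/
noncomputable def driftSupNorm (T : ℝ) (b : ℝ → ℝ → ℝ) : ℝ :=
  ⨆ p : Set.Icc (0 : ℝ) T × ℝ, |b p.1 p.2|

/-- The truncated variable
`Λ_K(t, y) = (2π)⁻¹ ∫_{-K}^{K} ∫_0^t b(s, y) i u exp(-i u (B_s - y)) ds du`. -/
noncomputable def truncLambda {Ω : Type*} (B : ℝ → Ω → ℝ) (b : ℝ → ℝ → ℝ)
    (t y K : ℝ) (ω : Ω) : ℂ :=
  (2 * (Real.pi : ℂ))⁻¹ * ∫ u in (-K)..K, ∫ s in (0 : ℝ)..t,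
    (b s y : ℂ) * (Complex.I * (u : ℂ)) *
      Complex.exp (-(Complex.I * (u : ℂ) * ((B s ω : ℂ) - (y : ℂ))))

/-- The random variable `L` is `Λ(t, y) = (2π)⁻¹ ∫_ℝ ∫_0^t b(s, y) i u exp(-i u (B_s - y)) ds du`,
the `u`-integral over `ℝ` being the limit in `L^p(P)`, for every finite `p`, of the integrals
over `[-K, K]` as `K → ∞`. -/
structure IsLambda {Ω : Type*} [MeasurableSpace Ω] (P : Measure Ω) (B : ℝ → Ω → ℝ)
    (b : ℝ → ℝ → ℝ) (t y : ℝ) (L : Ω → ℝ) : Prop where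
  memLp_trunc : ∀ (p : ℝ≥0) (K : ℝ), MemLp (truncLambda B b t y K) p P
  memLp : ∀ p : ℝ≥0, MemLp L p P
  tendsto : ∀ p : ℝ≥0,
    Tendsto (fun K : ℝ => eLpNorm (fun ω => truncLambda B b t y K ω - (L ω : ℂ)) p P)
      atTop (𝓝 0)

/-!
The variable `Λ(t, y)`, a weighted space derivative of local time, is controlled by its moments.
For even `m` the `m`-th moment of the truncated variable is, by Fubini's theorem and the Gaussian
characteristic function, an integral over times `s ∈ (0, t)^m` and frequencies `u ∈ ℝ^m` whose
integrand is at most `‖b‖^m * ∏ |u j| * exp (-Var (∑ u j * B (s j)) / 2)`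
(`lintegral_pow_enorm_setIntegral_le`). So everything rests on a lower bound for the variance that
is uniform in `m`.

Since `2 * H < 1`, the function `x ^ (2 * H)` is a mixture over `r > 0` of the functions
`min x r`, with density proportional to `r ^ (2 * H - 2)`, and `r - min |s - t| r` is the length
of `[s, s + r) ∩ [t, t + r)`. Hence the variance of `∑ u j * B (s j)` is a mixture of squared `L²`
norms of the step functions `∑ u j * (1_[s j, s j + r) - 1_[0, r))`. If `r` is at most the
distance `ρ j` from `s j` to `0` and to the other times, this function equals `u j` on
`[s j, s j + r)`. Integrating over `r` gives
`Var (∑ u j * B (s j)) ≥ (1 - 2 * H) / 2 * ∑ u j ^ 2 * ρ j ^ (2 * H)`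
(`sum_sq_mul_rpow_le_sum_fbmCov`).

This inequality is used twice (`lintegral_momentKernel_le`). Half of the Gaussian weight absorbs
the factors `|u j|`, each at the cost of `ρ j ^ (-H)`. The other half is integrated one variable
at a time, the conditional variance of `B (s j)` given the earlier times being at least a multiple
of `(s j - s (j - 1)) ^ (2 * H)` (`lintegral_exp_neg_norm_sq_le`). For ordered times the product
of all these costs is at most `C ^ m * ∏ (s j - s (j - 1)) ^ (-3 * H)`. This is integrable exactly
when `H < 1 / 3`, and the Dirichlet integral over the simplex
(`setLIntegral_openSimplex_prod_gap`) gives the quotient by `Γ (m * (1 - 3 * H) + 1)`, while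
passing from the cube to the simplex gives `m!`.

The same integral restricted to frequencies outside `(-K, K]` bounds the `m`-th moments of the
differences of truncated variables, and it tends to `0` by dominated convergence. So the truncated
variables are Cauchy in every `L^m`, and an almost sure limit along a subsequence is the limit in
all of these spaces at once (`exists_limit_of_eLpNorm_sub_le`).
-/

/-! ### Local nondeterminism of fractional Brownian motion -/

/-- The covariance function of fractional Brownian motion with Hurst parameter `H`. -/
noncomputable def fbmCov (H s t : ℝ) : ℝ :=
  (s ^ (2 * H) + t ^ (2 * H) - |s - t| ^ (2 * H)) / 2

/-- The power `x ^ (2 * H)` is a mixture of the functions `min x r`, because `2 * H < 1`. -/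
theorem integrableOn_min_mul_rpow {H x : ℝ} (hH0 : 0 < H) (hH : H < 1 / 2) (hx : 0 ≤ x) :
    IntegrableOn (fun r : ℝ => min x r * r ^ (2 * H - 2)) (Set.Ioi 0) ∧
    ∫ r in Set.Ioi (0 : ℝ), min x r * r ^ (2 * H - 2) = x ^ (2 * H) / (2 * H * (1 - 2 * H)) := by
  rcases hx.eq_or_lt with rfl | hx
  · have h : Set.EqOn (fun r : ℝ => min 0 r * r ^ (2 * H - 2)) (fun _ => 0) (Set.Ioi 0) := by
      intro r hr
      simp [min_eq_left (le_of_lt (Set.mem_Ioi.1 hr))]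
    refine ⟨(integrableOn_congr_fun h measurableSet_Ioi).2 integrableOn_zero, ?_⟩
    rw [setIntegral_congr_fun measurableSet_Ioi h,
      Real.zero_rpow (by positivity)]
    simp
  · have h1 : Set.EqOn (fun r : ℝ => min x r * r ^ (2 * H - 2)) (fun r => r ^ (2 * H - 1))
        (Set.Ioc 0 x) := by
      intro r hr
      simp only [min_eq_right hr.2]
      rw [show 2 * H - 1 = 1 + (2 * H - 2) by ring, Real.rpow_add hr.1, Real.rpow_one]
    have h2 : Set.EqOn (fun r : ℝ => min x r * r ^ (2 * H - 2)) (fun r => x * r ^ (2 * H - 2))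
        (Set.Ioi x) := by
      intro r hr
      simp only [min_eq_left (le_of_lt (Set.mem_Ioi.1 hr))]
    have i1 : IntegrableOn (fun r : ℝ => min x r * r ^ (2 * H - 2)) (Set.Ioc 0 x) := by
      refine (integrableOn_congr_fun h1 measurableSet_Ioc).2 ?_
      exact (intervalIntegrable_iff_integrableOn_Ioc_of_le hx.le).1
        (intervalIntegral.intervalIntegrable_rpow' (by linarith))
    have i2 : IntegrableOn (fun r : ℝ => min x r * r ^ (2 * H - 2)) (Set.Ioi x) := by
      refine (integrableOn_congr_fun h2 measurableSet_Ioi).2 ?_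
      exact (integrableOn_Ioi_rpow_of_lt (by linarith) hx).const_mul x
    have hu : Set.Ioi (0 : ℝ) = Set.Ioc 0 x ∪ Set.Ioi x := (Set.Ioc_union_Ioi_eq_Ioi hx.le).symm
    refine ⟨hu ▸ i1.union i2, ?_⟩
    rw [hu, setIntegral_union (Set.Ioc_disjoint_Ioi le_rfl) measurableSet_Ioi i1 i2,
      setIntegral_congr_fun measurableSet_Ioc h1, setIntegral_congr_fun measurableSet_Ioi h2,
      integral_const_mul, integral_Ioi_rpow_of_lt (by linarith) hx,
      ← intervalIntegral.integral_of_le hx.le, integral_rpow (Or.inl (by linarith))]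
    rw [Real.zero_rpow (by linarith), show 2 * H - 1 + 1 = 2 * H by ring,
      show 2 * H - 2 + 1 = 2 * H - 1 by ring]
    have e : x ^ (2 * H) = x * x ^ (2 * H - 1) := by
      rw [← Real.rpow_one_add' hx.le (by linarith)]; congr 1; ring
    have a1 : 1 - 2 * H ≠ 0 := by linarith
    have a2 : 2 * H - 1 ≠ 0 := by linarith
    have a3 : H ≠ 0 := hH0.ne'
    rw [e]
    field_simp
    ring

/-- The indicator function of the window `[s, s + r)`. -/
noncomputable def windowIndicator (r s : ℝ) : ℝ → ℝ :=
  (Set.Ico s (s + r)).indicator 1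

theorem windowIndicator_apply (r s x : ℝ) :
    windowIndicator r s x = if s ≤ x ∧ x < s + r then 1 else 0 := by
  simp [windowIndicator, Set.indicator_apply]

theorem windowIndicator_mul (r s t x : ℝ) :
    windowIndicator r s x * windowIndicator r t x =
      (Set.Ico s (s + r) ∩ Set.Ico t (t + r)).indicator (1 : ℝ → ℝ) x := by
  rw [windowIndicator, windowIndicator, ← Set.inter_indicator_mul]
  simp [Set.indicator_apply]

theorem integrable_windowIndicator_mul (r s t : ℝ) :
    Integrable (fun x => windowIndicator r s x * windowIndicator r t x) := by
  simp only [windowIndicator_mul]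
  refine (integrable_indicator_iff (measurableSet_Ico.inter measurableSet_Ico)).2 ?_
  refine integrableOn_const (ne_of_lt ?_)
  exact (measure_mono Set.inter_subset_left).trans_lt measure_Ico_lt_top

/-- Two windows of length `r` overlap in length `r - min |s - t| r`. -/
theorem integral_windowIndicator_mul (r s t : ℝ) :
    ∫ x, windowIndicator r s x * windowIndicator r t x = r - min |s - t| r := by
  simp only [windowIndicator_mul]
  rw [integral_indicator_one (measurableSet_Ico.inter measurableSet_Ico), Set.Ico_inter_Ico,
    Real.volume_real_Ico]
  rcases le_total s t with h | h
  · rw [abs_of_nonpos (by linarith), sup_eq_right.2 h, inf_eq_left.2 (by linarith)]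
    rcases le_total (-(s - t)) r with h' | h'
    · rw [min_eq_left h', max_eq_left (by linarith)]; ring
    · rw [min_eq_right h', max_eq_right (by linarith)]; ring
  · rw [abs_of_nonneg (by linarith), sup_eq_left.2 h, inf_eq_right.2 (by linarith)]
    rcases le_total (s - t) r with h' | h'
    · rw [min_eq_left h', max_eq_left (by linarith)]; ring
    · rw [min_eq_right h', max_eq_right (by linarith)]; ring

/-- The increment kernels `1_[s, s + r) - 1_[0, r)` represent the layer at `r` of the covariance. -/
theorem integral_sub_windowIndicator_mul {r : ℝ} (hr : 0 ≤ r) {s t : ℝ} (hs : 0 ≤ s) (ht : 0 ≤ t) :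
    Integrable (fun x => (windowIndicator r s x - windowIndicator r 0 x) *
      (windowIndicator r t x - windowIndicator r 0 x)) ∧
    ∫ x, (windowIndicator r s x - windowIndicator r 0 x) *
      (windowIndicator r t x - windowIndicator r 0 x) = min s r + min t r - min |s - t| r := by
  have e : (fun x => (windowIndicator r s x - windowIndicator r 0 x) *
      (windowIndicator r t x - windowIndicator r 0 x)) = fun x =>
      (windowIndicator r s x * windowIndicator r t x -
        windowIndicator r s x * windowIndicator r 0 x) -
      (windowIndicator r t x * windowIndicator r 0 x -
        windowIndicator r 0 x * windowIndicator r 0 x) := by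
    ext x; ring
  have i := integrable_windowIndicator_mul r
  have i1 : Integrable fun x => windowIndicator r s x * windowIndicator r t x -
    windowIndicator r s x * windowIndicator r 0 x := (i s t).sub (i s 0)
  have i2 : Integrable fun x => windowIndicator r t x * windowIndicator r 0 x -
    windowIndicator r 0 x * windowIndicator r 0 x := (i t 0).sub (i 0 0)
  rw [e]
  refine ⟨i1.sub i2, ?_⟩
  rw [integral_sub i1 i2, integral_sub (i s t) (i s 0),
    integral_sub (i t 0) (i 0 0)]
  simp only [integral_windowIndicator_mul, sub_zero, abs_of_nonneg hs, abs_of_nonneg ht, abs_zero,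
    min_eq_left hr]
  ring

/-- On the window `[s j, s j + r)` with `r ≤ ρ j`, only the `j`-th window contributes, so the
step function `∑ i, u i (1_[s i, s i + r) - 1_[0, r))` equals `u j` there. -/
theorem sum_ite_le_sq_sum_windowIndicator {ι : Type*} [Fintype ι] {s ρ : ι → ℝ} (u : ι → ℝ)
    (h0 : ∀ j, ρ j ≤ s j) (h1 : ∀ i j, i ≠ j → u i ≠ 0 → ρ j ≤ |s j - s i|) {r : ℝ} (x : ℝ) :
    ∑ j, (if r ≤ ρ j then u j ^ 2 * windowIndicator r (s j) x else 0) ≤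
      (∑ i, u i * (windowIndicator r (s i) x - windowIndicator r 0 x)) ^ 2 := by
  classical
  have key : ∀ j, r ≤ ρ j → s j ≤ x → x < s j + r →
      windowIndicator r 0 x = 0 ∧ ∀ i, i ≠ j → u i = 0 ∨ windowIndicator r (s i) x = 0 := by
    intro j hj hx hx'
    refine ⟨?_, fun i hi => ?_⟩
    · rw [windowIndicator_apply, if_neg]
      rintro ⟨_, h⟩
      linarith [h0 j]
    · refine or_iff_not_imp_left.2 fun hui => ?_
      rw [windowIndicator_apply, if_neg]
      rintro ⟨h, h'⟩
      have := h1 i j hi hui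
      rcases le_abs'.1 (hj.trans this) with h2 | h2 <;> linarith
  by_cases hex : ∃ j, r ≤ ρ j ∧ s j ≤ x ∧ x < s j + r
  · obtain ⟨j, hj, hx, hx'⟩ := hex
    obtain ⟨k0, k1⟩ := key j hj hx hx'
    rw [Finset.sum_eq_single j, Finset.sum_eq_single j]
    · rw [k0, windowIndicator_apply, if_pos hj, if_pos ⟨hx, hx'⟩]
      simp
    · intro i _ hi
      rcases k1 i hi with h | h <;> simp [k0, h]
    · simp
    · intro i _ hi
      rcases k1 i hi with h | h <;> simp [h]
    · simp
  · rw [Finset.sum_eq_zero]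
    · positivity
    · intro j _
      split_ifs with hj
      · rw [windowIndicator_apply, if_neg, mul_zero]
        exact fun h => hex ⟨j, hj, h.1, h.2⟩
      · rfl

/-- The layer at `r` of the variance is at least `r` times the sum of the `u j ^ 2` with
`r ≤ ρ j`. -/
theorem sum_ite_mul_le_sum_min {ι : Type*} [Fintype ι] {s ρ : ι → ℝ} (u : ι → ℝ)
    (hs : ∀ j, 0 ≤ s j) (h0 : ∀ j, ρ j ≤ s j) (h1 : ∀ i j, i ≠ j → u i ≠ 0 → ρ j ≤ |s j - s i|)
    {r : ℝ} (hr : 0 ≤ r) :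
    ∑ j, (if r ≤ ρ j then u j ^ 2 * r else 0) ≤
      ∑ i, ∑ j, u i * u j * (min (s i) r + min (s j) r - min |s i - s j| r) := by
  have hI := fun i j => integral_sub_windowIndicator_mul hr (hs i) (hs j)
  have e : ∀ x, (∑ i, u i * (windowIndicator r (s i) x - windowIndicator r 0 x)) ^ 2 =
      ∑ i, ∑ j, u i * u j * ((windowIndicator r (s i) x - windowIndicator r 0 x) *
        (windowIndicator r (s j) x - windowIndicator r 0 x)) := by
    intro x
    rw [sq, Finset.sum_mul_sum]
    refine Finset.sum_congr rfl fun i _ => Finset.sum_congr rfl fun j _ => by ring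
  have hw : ∀ a, Integrable (windowIndicator r a) := fun a => by
    refine (integrable_indicator_iff measurableSet_Ico).2 (integrableOn_const (by simp))
  have hw' : ∀ a, ∫ x, windowIndicator r a x = r := fun a => by
    rw [windowIndicator, integral_indicator_one measurableSet_Ico, Real.volume_real_Ico]
    simp [hr]
  have iL : ∀ j, Integrable
      (fun x => if r ≤ ρ j then u j ^ 2 * windowIndicator r (s j) x else 0) := by
    intro j
    split_ifs
    · exact (hw _).const_mul _
    · exact integrable_zero _ _ _
  have := integral_mono (integrable_finsetSum _ fun j _ => iL j) (g := fun x =>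
    (∑ i, u i * (windowIndicator r (s i) x - windowIndicator r 0 x)) ^ 2)
    (by
      simp only [e]
      exact integrable_finsetSum _ fun i _ => integrable_finsetSum _ fun j _ =>
        (hI i j).1.const_mul _)
    (fun x => sum_ite_le_sq_sum_windowIndicator u h0 h1 x)
  simp only [e] at this
  rw [integral_finsetSum _ fun j _ => iL j, integral_finsetSum _ fun i _ =>
    integrable_finsetSum _ fun j _ => (hI i j).1.const_mul _] at this
  refine le_trans (le_of_eq ?_) (this.trans (le_of_eq ?_))
  · refine Finset.sum_congr rfl fun j _ => ?_
    split_ifs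
    · rw [integral_const_mul, hw']
    · simp
  · refine Finset.sum_congr rfl fun i _ => ?_
    rw [integral_finsetSum _ fun j _ => (hI i j).1.const_mul _]
    refine Finset.sum_congr rfl fun j _ => ?_
    rw [integral_const_mul, (hI i j).2]

/-- **Local nondeterminism.** If every point `s j ≥ 0` is at distance at least `ρ j` from `0` and
from the other points that carry a nonzero coefficient, the variance of `∑ j, u j * B (s j)` is
bounded below by a multiple of
`∑ j, u j ^ 2 * ρ j ^ (2 * H)`, with a constant that does not depend on the number of points. -/
theorem sum_sq_mul_rpow_le_sum_fbmCov {H : ℝ} (hH0 : 0 < H) (hH : H < 1 / 2)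
    {ι : Type*} [Fintype ι] {s ρ : ι → ℝ} (u : ι → ℝ) (hs : ∀ j, 0 ≤ s j) (hρ : ∀ j, 0 ≤ ρ j)
    (h0 : ∀ j, ρ j ≤ s j) (h1 : ∀ i j, i ≠ j → u i ≠ 0 → ρ j ≤ |s j - s i|) :
    (1 - 2 * H) / 2 * ∑ j, u j ^ 2 * ρ j ^ (2 * H) ≤
      ∑ i, ∑ j, u i * u j * fbmCov H (s i) (s j) := by
  have hm := fun {x : ℝ} (hx : 0 ≤ x) => integrableOn_min_mul_rpow hH0 hH hx
  have iR : ∀ i j, IntegrableOn (fun r : ℝ => u i * u j *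
      (min (s i) r * r ^ (2 * H - 2) + min (s j) r * r ^ (2 * H - 2) -
        min |s i - s j| r * r ^ (2 * H - 2))) (Set.Ioi 0) := fun i j =>
    (((hm (hs i)).1.add (hm (hs j)).1).sub (hm (abs_nonneg _)).1).const_mul _
  have vR : ∀ i j, ∫ r in Set.Ioi (0 : ℝ), u i * u j *
      (min (s i) r * r ^ (2 * H - 2) + min (s j) r * r ^ (2 * H - 2) -
        min |s i - s j| r * r ^ (2 * H - 2)) =
      (H * (1 - 2 * H))⁻¹ * (u i * u j * fbmCov H (s i) (s j)) := by
    intro i j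
    have i1 : IntegrableOn (fun r : ℝ => min (s i) r * r ^ (2 * H - 2) +
        min (s j) r * r ^ (2 * H - 2)) (Set.Ioi 0) := (hm (hs i)).1.add (hm (hs j)).1
    rw [integral_const_mul, integral_sub i1 (hm (abs_nonneg _)).1,
      integral_add (hm (hs i)).1 (hm (hs j)).1, (hm (hs i)).2, (hm (hs j)).2,
      (hm (abs_nonneg _)).2, fbmCov]
    have : H ≠ 0 := hH0.ne'
    have : 1 - 2 * H ≠ 0 := by linarith
    field_simp
  have eL : ∀ j, Set.EqOn (fun r : ℝ => (if r ≤ ρ j then u j ^ 2 * r else 0) * r ^ (2 * H - 2))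
      ((Set.Ioc 0 (ρ j)).indicator fun r => u j ^ 2 * r ^ (2 * H - 1)) (Set.Ioi 0) := by
    intro j r hr
    have hr : 0 < r := hr
    by_cases h : r ≤ ρ j
    · rw [Set.indicator_of_mem (show r ∈ Set.Ioc 0 (ρ j) from ⟨hr, h⟩)]
      simp only [if_pos h]
      rw [show 2 * H - 1 = 1 + (2 * H - 2) by ring, Real.rpow_add hr, Real.rpow_one, mul_assoc]
    · rw [Set.indicator_of_notMem (fun h' => h h'.2)]
      simp [h]
  have iL' : ∀ j, IntegrableOn (fun r : ℝ => u j ^ 2 * r ^ (2 * H - 1)) (Set.Ioc 0 (ρ j)) := by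
    intro j
    exact ((intervalIntegrable_iff_integrableOn_Ioc_of_le (hρ j)).1
        (intervalIntegral.intervalIntegrable_rpow' (by linarith))).const_mul _
  have iL : ∀ j, IntegrableOn
      (fun r : ℝ => (if r ≤ ρ j then u j ^ 2 * r else 0) * r ^ (2 * H - 2)) (Set.Ioi 0) := by
    intro j
    refine (integrableOn_congr_fun (eL j) measurableSet_Ioi).2 ?_
    exact ((integrable_indicator_iff measurableSet_Ioc).2 (iL' j)).integrableOn
  have vL : ∀ j, ∫ r in Set.Ioi (0 : ℝ), (if r ≤ ρ j then u j ^ 2 * r else 0) * r ^ (2 * H - 2) =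
      u j ^ 2 * ρ j ^ (2 * H) / (2 * H) := by
    intro j
    rw [setIntegral_congr_fun measurableSet_Ioi (eL j), setIntegral_indicator measurableSet_Ioc,
      Set.inter_eq_self_of_subset_right Set.Ioc_subset_Ioi_self, integral_const_mul,
      ← intervalIntegral.integral_of_le (hρ j), integral_rpow (Or.inl (by linarith)),
      Real.zero_rpow (by linarith)]
    rw [show 2 * H - 1 + 1 = 2 * H by ring]
    ring
  have := setIntegral_mono_on (integrable_finsetSum Finset.univ fun j _ => iL j)
    (integrable_finsetSum Finset.univ fun i _ => integrable_finsetSum Finset.univ fun j _ => iR i j)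
    measurableSet_Ioi (fun r hr => ?_)
  · rw [integral_finsetSum _ fun j _ => iL j, integral_finsetSum _ fun i _ =>
      integrable_finsetSum _ fun j _ => iR i j] at this
    simp only [vL] at this
    rw [Finset.sum_congr rfl fun i _ => integral_finsetSum _ fun j _ => iR i j] at this
    simp only [vR, ← Finset.mul_sum, ← Finset.sum_div] at this
    have hp : 0 < H * (1 - 2 * H) := mul_pos hH0 (by linarith)
    rw [inv_mul_eq_div, le_div_iff₀ hp] at this
    refine le_trans (le_of_eq ?_) this
    field_simp
  · have hr : 0 < r := hr
    rw [← Finset.sum_mul]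
    refine (mul_le_mul_of_nonneg_right (sum_ite_mul_le_sum_min u hs h0 h1 hr.le)
      (Real.rpow_nonneg hr.le _)).trans (le_of_eq ?_)
    simp only [Finset.sum_mul]
    refine Finset.sum_congr rfl fun i _ => Finset.sum_congr rfl fun j _ => by ring

/-! ### Gaussian integrals by successive conditioning -/

theorem lintegral_exp_neg_mul_sq {b : ℝ} (hb : 0 < b) :
    ∫⁻ x : ℝ, ENNReal.ofReal (Real.exp (-(b * x) ^ 2)) = ENNReal.ofReal (√Real.pi / b) := by
  have h := integrable_exp_neg_mul_sq (b := b ^ 2) (by positivity)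
  have e : ∀ x : ℝ, -(b * x) ^ 2 = -b ^ 2 * x ^ 2 := fun x => by ring
  simp only [e]
  rw [← ofReal_integral_eq_lintegral_ofReal h (Eventually.of_forall fun x => (Real.exp_pos _).le),
    integral_gaussian, Real.sqrt_div' _ (by positivity), Real.sqrt_sq hb.le]

/-- A Gaussian integral is bounded by the product of the factors `√π / σ i`, where `σ i` is a lower
bound for the distance of `e i` to the span of the `e j`, `j < i`.
One integrates out the last variable after completing the square. -/
theorem lintegral_exp_neg_norm_sq_le {E : Type*} [NormedAddCommGroup E] [InnerProductSpace ℝ E]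
    (n : ℕ) (e : Fin n → E) (σ : Fin n → ℝ) (hσ : ∀ i, 0 < σ i)
    (h : ∀ (i : Fin n) (u : Fin n → ℝ), (∀ j, i < j → u j = 0) →
      σ i * |u i| ≤ ‖∑ j, u j • e j‖) :
    ∫⁻ u : Fin n → ℝ, ENNReal.ofReal (Real.exp (-‖∑ j, u j • e j‖ ^ 2)) ≤
      ∏ i, ENNReal.ofReal (√Real.pi / σ i) := by
  induction n with
  | zero => simp [volume_pi]
  | succ n ih =>
    have mp := (volume_preserving_piFinSuccAbove (fun _ : Fin (n + 1) => ℝ) (Fin.last n)).symm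
    rw [← mp.lintegral_comp_emb (MeasurableEquiv.measurableEmbedding _)]
    set V := Submodule.span ℝ (Set.range fun i : Fin n => e i.castSucc) with hV
    have : FiniteDimensional ℝ V := FiniteDimensional.span_of_finite ℝ (Set.finite_range _)
    -- `p` is the projection of the last vector on the span of the others, and `v` is the part of it
    -- orthogonal to that span
    obtain ⟨p, hp, v, hv, hpv⟩ := V.exists_add_mem_mem_orthogonal (e (Fin.last n))
    obtain ⟨a, ha⟩ := (Submodule.mem_span_range_iff_exists_fun ℝ).1 hp
    have hmem : ∀ w : Fin n → ℝ, ∑ j, w j • e j.castSucc ∈ V := fun w =>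
      V.sum_mem fun j _ => V.smul_mem _ (Submodule.subset_span ⟨j, rfl⟩)
    have hvn : σ (Fin.last n) ≤ ‖v‖ := by
      have := h (Fin.last n) (Fin.snoc (fun j => -a j) 1) (fun j hj => absurd hj (by
        exact not_lt.2 (Fin.le_last j)))
      rw [Fin.sum_univ_castSucc] at this
      simp only [Fin.snoc_last, Fin.snoc_castSucc, abs_one, mul_one, neg_smul,
        Finset.sum_neg_distrib, ha, one_smul, hpv] at this
      simpa using this
    have hsq : ∀ (x : ℝ) (w : Fin n → ℝ),
        ‖∑ j, (Fin.snoc w x : Fin (n + 1) → ℝ) j • e j‖ ^ 2 =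
        ‖∑ j, (w + x • a) j • e j.castSucc‖ ^ 2 + (x * ‖v‖) ^ 2 := by
      intro x w
      rw [Fin.sum_univ_castSucc]
      simp only [Fin.snoc_last, Fin.snoc_castSucc]
      have e1 : ∑ j, w j • e j.castSucc + x • e (Fin.last n) =
          ∑ j, (w + x • a) j • e j.castSucc + x • v := by
        rw [hpv, ← ha]
        simp only [Pi.add_apply, Pi.smul_apply, add_smul, Finset.sum_add_distrib, smul_add,
          Finset.smul_sum, smul_assoc]
        abel
      have e2 := norm_add_sq_eq_norm_sq_add_norm_sq_real (x := ∑ j, (w + x • a) j • e j.castSucc)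
        (y := x • v) ((Submodule.mem_orthogonal V _).1 (Vᗮ.smul_mem x hv) _ (hmem _))
      rw [e1, sq, e2, norm_smul, Real.norm_eq_abs, sq, mul_pow, ← sq_abs x]
      ring
    have cont : Continuous fun w : Fin n → ℝ => ∑ j, w j • e j.castSucc := by fun_prop
    have em : ∀ z : ℝ × (Fin n → ℝ), ENNReal.ofReal (Real.exp (-‖∑ j,
        ((MeasurableEquiv.piFinSuccAbove (fun _ => ℝ) (Fin.last n)).symm z) j • e j‖ ^ 2)) =
        ENNReal.ofReal (Real.exp (-‖∑ j, (z.2 + z.1 • a) j • e j.castSucc‖ ^ 2)) *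
          ENNReal.ofReal (Real.exp (-(‖v‖ * z.1) ^ 2)) := by
      intro z
      have : (MeasurableEquiv.piFinSuccAbove (fun _ => ℝ) (Fin.last n)).symm z =
          (Fin.snoc z.2 z.1 : Fin (n + 1) → ℝ) := by
        simp [MeasurableEquiv.piFinSuccAbove, Fin.insertNthEquiv, Fin.insertNth_last']
      rw [this, hsq, ← ENNReal.ofReal_mul (Real.exp_pos _).le, ← Real.exp_add]
      congr 2
      ring
    simp only [em]
    have meas : Measurable fun z : ℝ × (Fin n → ℝ) =>
        ENNReal.ofReal (Real.exp (-‖∑ j, (z.2 + z.1 • a) j • e j.castSucc‖ ^ 2)) *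
          ENNReal.ofReal (Real.exp (-(‖v‖ * z.1) ^ 2)) := by
      refine Measurable.mul (Measurable.ennreal_ofReal (Continuous.measurable ?_))
        (Measurable.ennreal_ofReal (Continuous.measurable ?_)) <;> fun_prop
    rw [Measure.volume_eq_prod, lintegral_prod _ meas.aemeasurable]
    have hin : ∀ x : ℝ, ∫⁻ w : Fin n → ℝ,
        ENNReal.ofReal (Real.exp (-‖∑ j, (w + x • a) j • e j.castSucc‖ ^ 2)) *
          ENNReal.ofReal (Real.exp (-(‖v‖ * x) ^ 2)) =
        (∫⁻ w : Fin n → ℝ, ENNReal.ofReal (Real.exp (-‖∑ j, w j • e j.castSucc‖ ^ 2))) *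
          ENNReal.ofReal (Real.exp (-(‖v‖ * x) ^ 2)) := by
      intro x
      rw [lintegral_mul_const' _ _ ENNReal.ofReal_ne_top]
      congr 1
      exact lintegral_add_right_eq_self (fun w : Fin n → ℝ =>
        ENNReal.ofReal (Real.exp (-‖∑ j, w j • e j.castSucc‖ ^ 2))) (x • a)
    -- by translation invariance the inner integral does not depend on `x` beyond the last factor
    simp only [hin]
    have hv0 : 0 < ‖v‖ := (hσ _).trans_le hvn
    rw [lintegral_const_mul _ (by fun_prop), lintegral_exp_neg_mul_sq hv0, Fin.prod_univ_castSucc]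
    gcongr
    · refine ih _ _ (fun i => hσ _) fun i u hu => ?_
      have := h i.castSucc (Fin.snoc u 0) (fun j hj => ?_)
      · rw [Fin.sum_univ_castSucc] at this
        simpa using this
      · refine Fin.lastCases (by simp) (fun j hj => ?_) j hj
        simpa using hu j (by simpa using hj)
    · exact hσ _

/-! ### The frequency integral for ordered times -/

/-- The variance of `∑ j, u j * B (s j)` for a fractional Brownian motion `B`. -/
noncomputable def fbmVar (H : ℝ) {m : ℕ} (s u : Fin m → ℝ) : ℝ :=
  ∑ i, ∑ j, u i * u j * fbmCov H (s i) (s j)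

/-- The integrand `∏ j, |u j| * exp (-Var (∑ j, u j * B (s j)) / 2)` that dominates the `m`-th
moment. -/
noncomputable def momentKernel (H : ℝ) {m : ℕ} (s u : Fin m → ℝ) : ℝ≥0∞ :=
  ENNReal.ofReal ((∏ j, |u j|) * Real.exp (-(fbmVar H s u / 2)))

/-- The gap between `s j` and its predecessor, the predecessor of `s 0` being `x`. -/
def gap (x : ℝ) {m : ℕ} (s : Fin m → ℝ) (j : Fin m) : ℝ :=
  s j - (Fin.cons x s : Fin (m + 1) → ℝ) j.castSucc

/-- With `g` listing the gaps between successive times followed by `T`, the nearest-neighbour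
distances are the minima of successive terms. Bounding `min a b ^ (-H)` by
`T ^ H * a ^ (-H) * b ^ (-H)`, every gap is used at most twice. -/
theorem prod_rpow_min_le {H T : ℝ} (hH0 : 0 ≤ H) (hT : 0 < T) {m : ℕ} (g : Fin (m + 1) → ℝ)
    (hg0 : ∀ j, 0 < g j) (hgT : ∀ j, g j ≤ T) (hlast : g (Fin.last m) = T) :
    ∏ j : Fin m, (min (g j.castSucc) (g j.succ)) ^ (-H) ≤
      ∏ j : Fin m, (T ^ H * g j.castSucc ^ (-(2 * H))) := by
  -- the larger of the two terms is at most `T`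
  have hmin : ∀ a b : ℝ, 0 < a → 0 < b → a ≤ T → b ≤ T →
      (min a b) ^ (-H) ≤ T ^ H * (a ^ (-H) * b ^ (-H)) := by
    intro a b ha hb haT hbT
    have hTb : ∀ c, 0 < c → c ≤ T → 1 ≤ T ^ H * c ^ (-H) := fun c hc hcT => by
      rw [Real.rpow_neg hc.le, ← div_eq_mul_inv, one_le_div (by positivity)]
      exact Real.rpow_le_rpow hc.le hcT hH0
    rcases le_total a b with h | h
    · rw [min_eq_left h]
      have := hTb b hb hbT
      have h2 : 0 < a ^ (-H) := by positivity
      nlinarith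
    · rw [min_eq_right h]
      have := hTb a ha haT
      have h2 : 0 < b ^ (-H) := by positivity
      nlinarith
  -- shifting the index drops `g 0` and adds the last term, which is the largest gap
  have hshift : ∏ j : Fin m, g j.succ ^ (-H) ≤ ∏ j : Fin m, g j.castSucc ^ (-H) := by
    have h1 := Fin.prod_univ_succ fun j => g j ^ (-H)
    have h2 := Fin.prod_univ_castSucc fun j => g j ^ (-H)
    have h3 : g (Fin.last m) ^ (-H) ≤ g 0 ^ (-H) := by
      rw [hlast]
      exact Real.rpow_le_rpow_of_nonpos (hg0 0) (hgT 0) (by linarith)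
    have h4 : 0 < g 0 ^ (-H) := Real.rpow_pos_of_pos (hg0 0) _
    have h5 : 0 ≤ ∏ j : Fin m, g j.castSucc ^ (-H) :=
      Finset.prod_nonneg fun j _ => (Real.rpow_pos_of_pos (hg0 _) _).le
    refine le_of_mul_le_mul_left ?_ h4
    rw [← h1, h2, mul_comm]
    exact mul_le_mul_of_nonneg_right h3 h5
  calc ∏ j : Fin m, (min (g j.castSucc) (g j.succ)) ^ (-H)
      ≤ ∏ j : Fin m, (T ^ H * (g j.castSucc ^ (-H) * g j.succ ^ (-H))) :=
        Finset.prod_le_prod (fun j _ => by have := hg0 j.castSucc; have := hg0 j.succ; positivity)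
          fun j _ => hmin _ _ (hg0 _) (hg0 _) (hgT _) (hgT _)
    _ = (∏ j : Fin m, T ^ H * g j.castSucc ^ (-H)) * ∏ j : Fin m, g j.succ ^ (-H) := by
        rw [← Finset.prod_mul_distrib]
        exact Finset.prod_congr rfl fun j _ => by ring
    _ ≤ (∏ j : Fin m, T ^ H * g j.castSucc ^ (-H)) * ∏ j : Fin m, g j.castSucc ^ (-H) :=
        mul_le_mul_of_nonneg_left hshift (Finset.prod_nonneg fun j _ => by
          have := hg0 j.castSucc; positivity)
    _ = ∏ j : Fin m, (T ^ H * g j.castSucc ^ (-(2 * H))) := by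
        rw [← Finset.prod_mul_distrib]
        refine Finset.prod_congr rfl fun j _ => ?_
        rw [mul_assoc, ← Real.rpow_add (hg0 _)]
        congr 2
        ring

theorem le_gap_of_lt {m : ℕ} {s : Fin m → ℝ} (hs : StrictMono s) {i j : Fin m} (hij : i < j)
    (x : ℝ) :
    gap x s j ≤ s j - s i := by
  obtain ⟨k, hk⟩ : ∃ k : Fin m, j.castSucc = k.succ ∧ i ≤ k := by
    have hij' : i.val < j.val := hij
    refine ⟨⟨j.val - 1, by omega⟩, ?_, ?_⟩
    · ext; simp; omega
    · rw [Fin.le_def]; simp; omega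
  rw [gap, hk.1, Fin.cons_succ]
  have := hs.monotone hk.2
  linarith

theorem gap_pos {m : ℕ} {s : Fin m → ℝ} (hs : StrictMono s) {x : ℝ} (hx : ∀ j, x < s j)
    (j : Fin m) : 0 < gap x s j := by
  rw [gap]
  rcases Nat.eq_zero_or_pos j.val with h | h
  · have : j.castSucc = (⟨0, by omega⟩ : Fin (m + 1)) := by ext; simp [h]
    rw [this]
    simpa using hx j
  · have : j.castSucc = (⟨j.val - 1, by omega⟩ : Fin m).succ := by ext; simp; omega
    rw [this, Fin.cons_succ, sub_pos]
    exact hs (by rw [Fin.lt_def]; simp; omega)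

theorem gap_le_sub {m : ℕ} {s : Fin m → ℝ} {x : ℝ} (hx : ∀ j, x < s j) (j : Fin m) :
    gap x s j ≤ s j - x := by
  rw [gap]
  refine sub_le_sub_left ?_ _
  exact Fin.cases (by simp) (fun k => by simpa using (hx k).le) j.castSucc

/-- For ordered times the `u`-integral of the moment kernel is bounded by the product of the
`(-3H)`-th powers of the gaps. Half of the Gaussian weight absorbs the factors `|u j|`, at a cost
`ρ j ^ (-H)` each, where `ρ j` is the distance from `s j` to the nearest other time; the other
half is integrated by conditioning successively on the past, at a cost `gap ^ (-H)` each. -/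
theorem lintegral_momentKernel_le {H T : ℝ} (hH0 : 0 < H) (hH : H < 1 / 2) (hT : 0 < T)
    {E : Type*} [NormedAddCommGroup E] [InnerProductSpace ℝ E] {m : ℕ} (s : Fin m → ℝ)
    (hs : StrictMono s) (hs0 : ∀ j, 0 < s j) (hsT : ∀ j, s j ≤ T) (e : Fin m → E)
    (he : ∀ i j, inner ℝ (e i) (e j) = fbmCov H (s i) (s j)) :
    ∫⁻ u, momentKernel H s u ≤
      ∏ j, ENNReal.ofReal (8 * √Real.pi * T ^ H / (1 - 2 * H) * gap 0 s j ^ (-(3 * H))) := by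
  set c : ℝ := (1 - 2 * H) / 2 with hc
  have hc0 : 0 < c := by rw [hc]; linarith
  have hgp := gap_pos hs hs0
  have hgle := gap_le_sub hs0
  have hnorm : ∀ u : Fin m → ℝ, ‖∑ j, u j • e j‖ ^ 2 = fbmVar H s u := by
    intro u
    rw [← real_inner_self_eq_norm_sq, sum_inner, fbmVar]
    refine Finset.sum_congr rfl fun i _ => ?_
    rw [inner_sum]
    refine Finset.sum_congr rfl fun j _ => ?_
    rw [real_inner_smul_left, real_inner_smul_right, he]
    ring
  -- the last time has no successor, so its missing right gap is replaced by `T`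
  set g : Fin (m + 1) → ℝ := Fin.snoc (gap 0 s) T with hg
  have hg0 : ∀ j, 0 < g j := fun j => by
    refine Fin.lastCases ?_ (fun k => ?_) j
    · simpa [hg] using hT
    · simpa [hg] using hgp k
  have hgT : ∀ j, g j ≤ T := fun j => by
    refine Fin.lastCases ?_ (fun k => ?_) j
    · simp [hg]
    · simpa [hg] using (hgle k).trans (by simpa using hsT k)
  set ρ : Fin m → ℝ := fun j => min (g j.castSucc) (g j.succ) with hρ
  have hρ0 : ∀ j, 0 < ρ j := fun j => lt_min (hg0 _) (hg0 _)
  have hρg : ∀ j, ρ j ≤ gap 0 s j := fun j => (min_le_left _ _).trans (by simp [hg])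
  have hvar : ∀ u : Fin m → ℝ, c * ∑ j, u j ^ 2 * ρ j ^ (2 * H) ≤ fbmVar H s u := by
    intro u
    refine sum_sq_mul_rpow_le_sum_fbmCov hH0 hH u (fun j => (hs0 j).le) (fun j => (hρ0 j).le)
      (fun j => (hρg j).trans (by simpa using hgle j)) fun i j hij _ => ?_
    rcases lt_or_gt_of_ne hij with h | h
    · exact ((hρg j).trans (le_gap_of_lt hs h 0)).trans (le_abs_self _)
    · have hij' : j.val < i.val := h
      have : ∃ k : Fin m, j.succ = k.castSucc ∧ k ≤ i :=
        ⟨⟨j.val + 1, by omega⟩, by ext; simp, by rw [Fin.le_def]; simp; omega⟩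
      obtain ⟨k, hk, hki⟩ := this
      have h1 : ρ j ≤ gap 0 s k := (min_le_right _ _).trans (by rw [hk]; simp [hg])
      have h2 : gap 0 s k = s k - s j := by
        rw [gap, ← hk, Fin.cons_succ]
      have h3 := hs.monotone hki
      rw [abs_sub_comm]
      exact (h1.trans (by rw [h2]; linarith)).trans (le_abs_self _)
  -- if no later time contributes, `s i` may be compared with its predecessor alone, so the local
  -- nondeterminism bound applies with all other radii equal to zero
  have hvar1 : ∀ (i : Fin m) (u : Fin m → ℝ), (∀ j, i < j → u j = 0) →
      c * (u i ^ 2 * gap 0 s i ^ (2 * H)) ≤ fbmVar H s u := by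
    intro i u hu
    have := sum_sq_mul_rpow_le_sum_fbmCov hH0 hH (s := s) (ρ := Pi.single i (gap 0 s i)) u
      (fun j => (hs0 j).le) (fun j => ?_) (fun j => ?_) fun k j hkj huk => ?_
    · refine le_trans (mul_le_mul_of_nonneg_left ?_ hc0.le) this
      refine le_trans (le_of_eq ?_) (Finset.single_le_sum (fun j _ => ?_) (Finset.mem_univ i))
      · simp
      · refine mul_nonneg (sq_nonneg _) (Real.rpow_nonneg ?_ _)
        by_cases h : j = i
        · subst h; simpa using (hgp j).le
        · simp [h]
    · by_cases h : j = i
      · subst h; simpa using (hgp j).le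
      · simp [h]
    · by_cases h : j = i
      · subst h; simpa using hgle j
      · simpa [h] using (hs0 j).le
    · by_cases h : j = i
      · subst h
        have : k < j := lt_of_le_of_ne (not_lt.1 fun h' => huk (hu k h')) hkj
        simpa using (le_gap_of_lt hs this 0).trans (le_abs_self _)
      · simp [h]
  -- the elementary inequality `x ≤ exp (x ^ 2)` absorbs `|u j|` into half of the weight
  have hpt : ∀ u : Fin m → ℝ, momentKernel H s u ≤
      ENNReal.ofReal (∏ j, (2 / √c * ρ j ^ (-H))) *
        ENNReal.ofReal (Real.exp (-‖∑ j, u j • ((1 / 2 : ℝ) • e j)‖ ^ 2)) := by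
    intro u
    have hp : 0 ≤ ∏ j, (2 / √c * ρ j ^ (-H)) :=
      Finset.prod_nonneg fun j _ => by have := hρ0 j; positivity
    rw [momentKernel, ← ENNReal.ofReal_mul hp]
    refine ENNReal.ofReal_le_ofReal ?_
    have hn : ‖∑ j, u j • ((1 / 2 : ℝ) • e j)‖ ^ 2 = fbmVar H s u / 4 := by
      simp only [smul_comm _ (1 / 2 : ℝ), ← Finset.smul_sum]
      rw [norm_smul, mul_pow, hnorm]
      norm_num
      ring
    have h1 : ∀ j, |u j| ≤ 2 / √c * ρ j ^ (-H) * Real.exp (c / 4 * (u j ^ 2 * ρ j ^ (2 * H))) := by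
      intro j
      have hsc : 0 < √c := Real.sqrt_pos.2 hc0
      have hr : 0 < ρ j ^ H := Real.rpow_pos_of_pos (hρ0 j) _
      set x := √c / 2 * ρ j ^ H * |u j| with hx
      have hxe : x ≤ Real.exp (x ^ 2) := by
        have := Real.add_one_le_exp (x ^ 2)
        nlinarith [sq_nonneg (x - 1)]
      have hx2 : x ^ 2 = c / 4 * (u j ^ 2 * ρ j ^ (2 * H)) := by
        rw [hx, mul_pow, mul_pow, div_pow, Real.sq_sqrt hc0.le, sq_abs, mul_comm 2 H,
          Real.rpow_mul (hρ0 j).le, Real.rpow_two]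
        ring
      rw [← hx2, Real.rpow_neg (hρ0 j).le]
      calc |u j| = 2 / √c * (ρ j ^ H)⁻¹ * x := by rw [hx]; field_simp
        _ ≤ _ := by gcongr
    rw [hn]
    calc (∏ j, |u j|) * Real.exp (-(fbmVar H s u / 2))
        ≤ (∏ j, (2 / √c * ρ j ^ (-H) * Real.exp (c / 4 * (u j ^ 2 * ρ j ^ (2 * H))))) *
          Real.exp (-(fbmVar H s u / 2)) := by
          refine mul_le_mul_of_nonneg_right ?_ (Real.exp_pos _).le
          exact Finset.prod_le_prod (fun j _ => abs_nonneg _) fun j _ => h1 j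
      _ = (∏ j, (2 / √c * ρ j ^ (-H))) * Real.exp (c / 4 * (∑ j, u j ^ 2 * ρ j ^ (2 * H)) -
            fbmVar H s u / 2) := by
          rw [Finset.prod_mul_distrib, ← Real.exp_sum, ← Finset.mul_sum, mul_assoc, ← Real.exp_add,
            sub_eq_add_neg]
      _ ≤ _ := by
          refine mul_le_mul_of_nonneg_left (Real.exp_le_exp.2 ?_) hp
          linarith [hvar u]
  calc ∫⁻ u, momentKernel H s u
      ≤ ∫⁻ u : Fin m → ℝ, ENNReal.ofReal (∏ j, (2 / √c * ρ j ^ (-H))) *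
        ENNReal.ofReal (Real.exp (-‖∑ j, u j • ((1 / 2 : ℝ) • e j)‖ ^ 2)) := lintegral_mono hpt
    _ = ENNReal.ofReal (∏ j, (2 / √c * ρ j ^ (-H))) * ∫⁻ u : Fin m → ℝ,
        ENNReal.ofReal (Real.exp (-‖∑ j, u j • ((1 / 2 : ℝ) • e j)‖ ^ 2)) :=
        lintegral_const_mul' _ _ ENNReal.ofReal_ne_top
    _ ≤ ENNReal.ofReal (∏ j, (2 / √c * ρ j ^ (-H))) *
        ∏ j, ENNReal.ofReal (√Real.pi / (√c / 2 * gap 0 s j ^ H)) := by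
        refine mul_le_mul_right
          (lintegral_exp_neg_norm_sq_le m _ _ (fun i => ?_) fun i u hu => ?_) _
        · have := hgp i
          have := Real.sqrt_pos.2 hc0
          positivity
        · simp only [smul_comm _ (1 / 2 : ℝ), ← Finset.smul_sum]
          rw [norm_smul]
          refine le_of_sq_le_sq ?_ (by positivity)
          rw [mul_pow, mul_pow, mul_pow, div_pow, hnorm, Real.sq_sqrt hc0.le, sq_abs]
          have h2 : (gap 0 s i ^ H) ^ 2 = gap 0 s i ^ (2 * H) := by
            rw [mul_comm 2 H, Real.rpow_mul (hgp i).le, Real.rpow_two]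
          have := hvar1 i u hu
          rw [h2]
          norm_num
          linarith
    _ = ENNReal.ofReal ((∏ j, ρ j ^ (-H)) *
          ∏ j, (4 * √Real.pi / c * gap 0 s j ^ (-H))) := by
        rw [← ENNReal.ofReal_prod_of_nonneg (fun j _ => by have := hgp j; positivity),
          ← ENNReal.ofReal_mul (Finset.prod_nonneg fun j _ => by have := hρ0 j; positivity),
          ← Finset.prod_mul_distrib, ← Finset.prod_mul_distrib]
        congr 1
        refine Finset.prod_congr rfl fun j _ => ?_
        have hsc : √c * √c = c := Real.mul_self_sqrt hc0.le
        have hsc0 : 0 < √c := Real.sqrt_pos.2 hc0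
        rw [Real.rpow_neg (hgp j).le]
        have := Real.rpow_pos_of_pos (hgp j) H
        rw [show 4 * √Real.pi / c = 4 * √Real.pi / (√c * √c) by rw [hsc]]
        field_simp
        ring
    _ ≤ ENNReal.ofReal ((∏ j, (T ^ H * gap 0 s j ^ (-(2 * H)))) *
          ∏ j, (4 * √Real.pi / c * gap 0 s j ^ (-H))) := by
        refine ENNReal.ofReal_le_ofReal (mul_le_mul_of_nonneg_right ?_
          (Finset.prod_nonneg fun j _ => by have := hgp j; positivity))
        refine (prod_rpow_min_le hH0.le hT g hg0 hgT (by simp [hg])).trans (le_of_eq ?_)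
        simp [hg]
    _ = _ := by
        rw [← Finset.prod_mul_distrib,
          ENNReal.ofReal_prod_of_nonneg (fun j _ => by have := hgp j; positivity)]
        refine Finset.prod_congr rfl fun j _ => ?_
        congr 1
        rw [show -(3 * H) = -(2 * H) + -H by ring, Real.rpow_add (hgp j)]
        rw [hc]
        have : 1 - 2 * H ≠ 0 := by linarith
        field_simp
        ring

/-! ### The Dirichlet integral over the ordered simplex -/

theorem lintegral_beta_Ioo {α β : ℝ} (hα : 0 < α) (hβ : 0 < β) :
    ∫⁻ x in Set.Ioo (0 : ℝ) 1, ENNReal.ofReal (x ^ (α - 1) * (1 - x) ^ (β - 1)) =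
      ENNReal.ofReal (Real.Gamma α * Real.Gamma β / Real.Gamma (α + β)) := by
  have h := lintegral_betaPDF_eq_one hα hβ
  rw [lintegral_betaPDF] at h
  have hb : 0 < beta α β := beta_pos hα hβ
  have e : ∀ x : ℝ, ENNReal.ofReal (1 / beta α β * x ^ (α - 1) * (1 - x) ^ (β - 1)) =
      ENNReal.ofReal (1 / beta α β) * ENNReal.ofReal (x ^ (α - 1) * (1 - x) ^ (β - 1)) := by
    intro x
    rw [← ENNReal.ofReal_mul (by positivity), mul_assoc]
  simp only [e] at h
  rw [lintegral_const_mul' _ _ ENNReal.ofReal_ne_top] at h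
  rw [← one_mul (lintegral _ _), show (1 : ℝ≥0∞) =
    ENNReal.ofReal (beta α β) * ENNReal.ofReal (1 / beta α β) by
      rw [← ENNReal.ofReal_mul hb.le, mul_one_div_cancel hb.ne', ENNReal.ofReal_one], mul_assoc, h,
    mul_one]
  rfl

theorem lintegral_sub_rpow_mul_sub_rpow {α β x t : ℝ} (hα : 0 < α) (hβ : 0 < β) (hxt : x < t) :
    ∫⁻ a in Set.Ioo x t, ENNReal.ofReal ((a - x) ^ (α - 1) * (t - a) ^ (β - 1)) =
      ENNReal.ofReal (Real.Gamma α * Real.Gamma β / Real.Gamma (α + β) *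
        (t - x) ^ (α + β - 1)) := by
  have ht : 0 < t - x := sub_pos.2 hxt
  have him : (fun y : ℝ => x + (t - x) * y) '' Set.Ioo 0 1 = Set.Ioo x t := by
    ext z
    simp only [Set.mem_image, Set.mem_Ioo]
    constructor
    · rintro ⟨y, ⟨h0, h1⟩, rfl⟩
      exact ⟨by nlinarith, by nlinarith⟩
    · rintro ⟨h0, h1⟩
      refine ⟨(z - x) / (t - x), ⟨by have := sub_pos.2 h0; positivity, ?_⟩, by field_simp; ring⟩
      rw [div_lt_one ht]
      linarith
  rw [← him, lintegral_image_eq_lintegral_abs_deriv_mul (f' := fun _ => t - x) measurableSet_Ioo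
    (fun y _ => by
      have := ((hasDerivAt_id y).const_mul (t - x)).const_add x
      simpa using this.hasDerivWithinAt)
    (fun y _ z _ h => by
      have h : x + (t - x) * y = x + (t - x) * z := h
      exact mul_left_cancel₀ ht.ne' (add_left_cancel h))]
  have : Set.EqOn (fun y : ℝ => ENNReal.ofReal |t - x| * ENNReal.ofReal
      ((x + (t - x) * y - x) ^ (α - 1) * (t - (x + (t - x) * y)) ^ (β - 1)))
      (fun y => ENNReal.ofReal ((t - x) ^ (α + β - 1)) *
        ENNReal.ofReal (y ^ (α - 1) * (1 - y) ^ (β - 1))) (Set.Ioo 0 1) := by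
    intro y hy
    simp only
    rw [← ENNReal.ofReal_mul (abs_nonneg _), ← ENNReal.ofReal_mul (by positivity)]
    congr 1
    rw [abs_of_pos ht, show x + (t - x) * y - x = (t - x) * y by ring,
      show t - (x + (t - x) * y) = (t - x) * (1 - y) by ring, Real.mul_rpow ht.le hy.1.le,
      Real.mul_rpow ht.le (by linarith [hy.2]),
      show α + β - 1 = 1 + (α - 1) + (β - 1) by ring, Real.rpow_add ht, Real.rpow_add ht,
      Real.rpow_one]
    ring
  rw [setLIntegral_congr_fun measurableSet_Ioo this,
    lintegral_const_mul' _ _ ENNReal.ofReal_ne_top, lintegral_beta_Ioo hα hβ,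
    ← ENNReal.ofReal_mul (by positivity), mul_comm]

/-- The open simplex `x < s 0 < ⋯ < s (m - 1) < t`. -/
def openSimplex (x t : ℝ) (m : ℕ) : Set (Fin m → ℝ) :=
  {s | StrictMono s ∧ ∀ j, s j ∈ Set.Ioo x t}

theorem measurableSet_openSimplex (x t : ℝ) (m : ℕ) : MeasurableSet (openSimplex x t m) := by
  simp only [openSimplex, StrictMono, Set.ofPred_and, Set.ofPred_forall]
  refine MeasurableSet.inter ?_ ?_
  · refine MeasurableSet.iInter fun i => MeasurableSet.iInter fun j =>
      MeasurableSet.iInter fun _ => ?_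
    exact measurableSet_lt (measurable_pi_apply i) (measurable_pi_apply j)
  · exact MeasurableSet.iInter fun j => measurableSet_Ioo.preimage (measurable_pi_apply j)

theorem cons_mem_openSimplex {x t a : ℝ} {m : ℕ} {s : Fin m → ℝ} :
    (Fin.cons a s : Fin (m + 1) → ℝ) ∈ openSimplex x t (m + 1) ↔
      a ∈ Set.Ioo x t ∧ s ∈ openSimplex a t m := by
  simp only [openSimplex, Set.mem_ofPred_eq, Fin.forall_fin_succ, Fin.cons_zero, Fin.cons_succ,
    Set.mem_Ioo]
  constructor
  · rintro ⟨hm, ha, hs⟩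
    refine ⟨ha, fun i j hij => ?_, fun j => ⟨?_, (hs j).2⟩⟩
    · simpa using hm (Fin.succ_lt_succ_iff.2 hij)
    · simpa using hm (Fin.succ_pos j)
  · rintro ⟨ha, hm, hs⟩
    refine ⟨?_, ha, fun j => ⟨ha.1.trans (hs j).1, (hs j).2⟩⟩
    intro i j hij
    induction j using Fin.cases with
    | zero => exact absurd hij (Fin.not_lt_zero i)
    | succ j =>
      induction i using Fin.cases with
      | zero => simpa using (hs j).1
      | succ i => simpa using hm (Fin.succ_lt_succ_iff.1 hij)

theorem measurable_gap (x : ℝ) {m : ℕ} (j : Fin m) : Measurable fun s : Fin m → ℝ => gap x s j := by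
  unfold gap
  refine (measurable_pi_apply j).sub ?_
  exact Fin.cases (by simp) (fun k => by simpa using measurable_pi_apply k) j.castSucc

theorem gap_cons_zero (x a : ℝ) {m : ℕ} (s : Fin m → ℝ) :
    gap x (Fin.cons a s : Fin (m + 1) → ℝ) 0 = a - x := by
  simp [gap]

theorem gap_cons_succ (x a : ℝ) {m : ℕ} (s : Fin m → ℝ) (j : Fin m) :
    gap x (Fin.cons a s : Fin (m + 1) → ℝ) j.succ = gap a s j := by
  simp [gap]

/-- The Dirichlet integral over the ordered simplex, in terms of the gaps. -/
theorem setLIntegral_openSimplex_prod_gap {a : ℝ} (ha : 0 < a) (t : ℝ) (m : ℕ) (x : ℝ)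
    (hx : x < t) :
    ∫⁻ s in openSimplex x t m, ∏ j, ENNReal.ofReal (gap x s j ^ (a - 1)) =
      ENNReal.ofReal (Real.Gamma a ^ m * (t - x) ^ (m * a) / Real.Gamma (m * a + 1)) := by
  induction m generalizing x with
  | zero =>
    have : openSimplex x t 0 = Set.univ := by
      ext s; simp [openSimplex, Subsingleton.strictMono]
    simp [this, volume_pi]
  | succ m ih =>
    have mp := (volume_preserving_piFinSuccAbove (fun _ : Fin (m + 1) => ℝ) 0).symm
    have hcons : ∀ z : ℝ × (Fin m → ℝ), (MeasurableEquiv.piFinSuccAbove (fun _ => ℝ) 0).symm z =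
        (Fin.cons z.1 z.2 : Fin (m + 1) → ℝ) := by
      intro z
      simp [MeasurableEquiv.piFinSuccAbove, Fin.insertNthEquiv]
    have hmeas : ∀ (n : ℕ) (x : ℝ), Measurable fun s : Fin n → ℝ =>
        ∏ j, ENNReal.ofReal (gap x s j ^ (a - 1)) := fun n x =>
      Finset.measurable_prod _ fun j _ => ((measurable_gap x j).pow_const _).ennreal_ofReal
    have hm : Measurable fun z : ℝ × (Fin m → ℝ) => (openSimplex x t (m + 1)).indicator
        (fun s => ∏ j, ENNReal.ofReal (gap x s j ^ (a - 1)))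
        ((MeasurableEquiv.piFinSuccAbove (fun _ => ℝ) 0).symm z) :=
      ((hmeas _ _).indicator (measurableSet_openSimplex _ _ _)).comp (MeasurableEquiv.measurable _)
    rw [← lintegral_indicator (measurableSet_openSimplex _ _ _),
      ← mp.lintegral_comp_emb (MeasurableEquiv.measurableEmbedding _), Measure.volume_eq_prod,
      lintegral_prod _ hm.aemeasurable]
    simp only [hcons]
    have hin : ∀ y : ℝ, ∫⁻ s : Fin m → ℝ, (openSimplex x t (m + 1)).indicator
        (fun s => ∏ j, ENNReal.ofReal (gap x s j ^ (a - 1))) (Fin.cons y s : Fin (m + 1) → ℝ) =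
        (Set.Ioo x t).indicator (fun y => ENNReal.ofReal ((y - x) ^ (a - 1)) *
          ENNReal.ofReal (Real.Gamma a ^ m * (t - y) ^ (m * a) / Real.Gamma (m * a + 1))) y := by
      intro y
      by_cases hy : y ∈ Set.Ioo x t
      · rw [Set.indicator_of_mem hy, ← ih y hy.2, ← lintegral_const_mul' _ _ ENNReal.ofReal_ne_top,
          ← lintegral_indicator (measurableSet_openSimplex _ _ _)]
        refine lintegral_congr fun s => ?_
        by_cases hs : s ∈ openSimplex y t m
        · rw [Set.indicator_of_mem hs, Set.indicator_of_mem (cons_mem_openSimplex.2 ⟨hy, hs⟩),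
            Fin.prod_univ_succ]
          simp only [gap_cons_zero, gap_cons_succ]
        · rw [Set.indicator_of_notMem hs,
            Set.indicator_of_notMem fun h => hs (cons_mem_openSimplex.1 h).2]
      · rw [Set.indicator_of_notMem hy]
        simp only [Set.indicator_of_notMem fun h => hy (cons_mem_openSimplex.1 h).1, lintegral_zero]
    simp only [hin]
    rw [lintegral_indicator measurableSet_Ioo]
    have hG1 : 0 < Real.Gamma (m * a + 1) := Real.Gamma_pos_of_pos (by positivity)
    have hG : 0 < Real.Gamma a := Real.Gamma_pos_of_pos ha
    have hfac : Set.EqOn (fun y : ℝ => ENNReal.ofReal ((y - x) ^ (a - 1)) *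
          ENNReal.ofReal (Real.Gamma a ^ m * (t - y) ^ (m * a) / Real.Gamma (m * a + 1)))
        (fun y => ENNReal.ofReal (Real.Gamma a ^ m / Real.Gamma (m * a + 1)) *
          ENNReal.ofReal ((y - x) ^ (a - 1) * (t - y) ^ (m * a + 1 - 1))) (Set.Ioo x t) := by
      intro y hy
      have h1 : 0 < y - x := sub_pos.2 hy.1
      simp only
      rw [← ENNReal.ofReal_mul (by positivity), ← ENNReal.ofReal_mul (by positivity)]
      congr 1
      rw [add_sub_cancel_right]
      ring
    rw [setLIntegral_congr_fun measurableSet_Ioo hfac,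
      lintegral_const_mul' _ _ ENNReal.ofReal_ne_top,
      lintegral_sub_rpow_mul_sub_rpow ha (by positivity) hx, ← ENNReal.ofReal_mul (by positivity)]
    congr 1
    have e1 : a + (m * a + 1) - 1 = ((m + 1 : ℕ) : ℝ) * a := by push_cast; ring
    have e2 : a + (m * a + 1) = ((m + 1 : ℕ) : ℝ) * a + 1 := by push_cast; ring
    rw [e1, e2]
    field_simp
    ring

theorem piCongrLeft_perm_symm {m : ℕ} (σ : Equiv.Perm (Fin m)) (s : Fin m → ℝ) :
    MeasurableEquiv.piCongrLeft (fun _ : Fin m => ℝ) σ.symm s = s ∘ σ := by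
  ext j
  have := Equiv.piCongrLeft_apply_apply (fun _ : Fin m => ℝ) σ.symm s (σ j)
  simpa [MeasurableEquiv.coe_piCongrLeft] using this

/-- The integral over the cube `(x, t)^m` of a symmetric function is at most `m!` times its
integral over the ordered simplex. -/
theorem lintegral_cube_le_factorial_mul_openSimplex {x t : ℝ} {m : ℕ} (F : (Fin m → ℝ) → ℝ≥0∞)
    (hF : ∀ (s : Fin m → ℝ) (σ : Equiv.Perm (Fin m)), F (s ∘ σ) = F s) :
    ∫⁻ s in {s : Fin m → ℝ | ∀ j, s j ∈ Set.Ioo x t}, F s ≤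
      (m ! : ℝ≥0∞) * ∫⁻ s in openSimplex x t m, F s := by
  -- points with two equal coordinates form a null set
  set D : Set (Fin m → ℝ) := {s | ¬ Function.Injective s} with hD
  have hD0 : volume D = 0 := by
    have : D ⊆ ⋃ i, ⋃ j, ⋃ _ : i ≠ j, {s : Fin m → ℝ | s i = s j} := by
      intro s hs
      simp only [hD, Set.mem_ofPred_eq, Function.Injective, not_forall] at hs
      obtain ⟨i, j, h, hij⟩ := hs
      simp only [Set.mem_iUnion]
      exact ⟨i, j, hij, h⟩
    refine measure_mono_null this ?_
    refine measure_iUnion_null fun i => measure_iUnion_null fun j =>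
      measure_iUnion_null fun hij => ?_
    -- a hyperplane is a proper subspace
    let V : Submodule ℝ (Fin m → ℝ) :=
      LinearMap.ker ((LinearMap.proj i : (Fin m → ℝ) →ₗ[ℝ] ℝ) - LinearMap.proj j)
    have hV : {s : Fin m → ℝ | s i = s j} = V := by
      ext s; simp [V, sub_eq_zero]
    rw [hV]
    refine Measure.addHaar_submodule _ V fun h => ?_
    have : (Pi.single i 1 : Fin m → ℝ) ∈ V := h ▸ Submodule.mem_top
    simp [V, Pi.single_eq_of_ne (Ne.symm hij)] at this
  -- sorting a point with distinct coordinates moves it into the simplex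
  have hsub : {s : Fin m → ℝ | ∀ j, s j ∈ Set.Ioo x t} ⊆
      D ∪ ⋃ σ : Equiv.Perm (Fin m), {s | s ∘ σ ∈ openSimplex x t m} := by
    intro s hs
    by_cases hinj : Function.Injective s
    · refine Or.inr (Set.mem_iUnion.2 ⟨Tuple.sort s, ?_, fun j => hs _⟩)
      exact (Tuple.monotone_sort s).strictMono_of_injective (hinj.comp (Equiv.injective _))
    · exact Or.inl hinj
  have hperm : ∀ σ : Equiv.Perm (Fin m),
      ∫⁻ s in {s | s ∘ σ ∈ openSimplex x t m}, F s = ∫⁻ s in openSimplex x t m, F s := by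
    intro σ
    have mp := volume_measurePreserving_piCongrLeft (fun _ : Fin m => ℝ) σ.symm
    have := mp.setLIntegral_comp_preimage_emb (MeasurableEquiv.measurableEmbedding _) F
      (openSimplex x t m)
    simp only [piCongrLeft_perm_symm, hF] at this
    rw [← this]
    congr 2
    ext s
    simp [piCongrLeft_perm_symm]
  calc ∫⁻ s in {s : Fin m → ℝ | ∀ j, s j ∈ Set.Ioo x t}, F s
      ≤ ∫⁻ s in D ∪ ⋃ σ : Equiv.Perm (Fin m), {s | s ∘ σ ∈ openSimplex x t m}, F s :=
        lintegral_mono_set hsub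
    _ ≤ (∫⁻ s in D, F s) + ∫⁻ s in ⋃ σ : Equiv.Perm (Fin m), {s | s ∘ σ ∈ openSimplex x t m}, F s :=
        lintegral_union_le _ _ _
    _ ≤ 0 + ∑' σ : Equiv.Perm (Fin m), ∫⁻ s in {s | s ∘ σ ∈ openSimplex x t m}, F s := by
        exact add_le_add (setLIntegral_measure_zero _ _ hD0).le (lintegral_iUnion_le _ _)
    _ = _ := by
        simp only [hperm, zero_add, tsum_fintype, Finset.sum_const, Finset.card_univ,
          Fintype.card_perm, Fintype.card_fin, nsmul_eq_mul]

/-! ### Joint measurability and Gaussian characteristic functions -/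

/-- A fractional Brownian motion agrees, outside a null set and for all times in `[0, T]`, with a
jointly measurable process. -/
theorem IsFractionalBrownianMotion.exists_measurable_modification {Ω : Type*} [MeasurableSpace Ω]
    {P : Measure Ω} {H T : ℝ} {B : ℝ → Ω → ℝ} (hT : 0 ≤ T)
    (hB : IsFractionalBrownianMotion P H T B) :
    ∃ B' : ℝ → Ω → ℝ, Measurable (Function.uncurry B') ∧
      ∀ᵐ ω ∂P, ∀ s ∈ Set.Icc (0 : ℝ) T, B' s ω = B s ω := by
  classical
  have : Nonempty (Set.Icc (0 : ℝ) T) := ⟨⟨0, le_rfl, hT⟩⟩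
  let d : ℕ → Set.Icc (0 : ℝ) T := TopologicalSpace.denseSeq _
  have hd : DenseRange d := TopologicalSpace.denseRange_denseSeq _
  have hae : ∀ s : Set.Icc (0 : ℝ) T, AEMeasurable (B s) P := fun s => hB.gaussian.aemeasurable s
  have hgood : ∀ᵐ ω ∂P, ContinuousOn (fun t => B t ω) (Set.Icc (0 : ℝ) T) ∧
      ∀ n, B (d n) ω = (hae (d n)).mk _ ω := by
    refine hB.continuous_paths.and (ae_all_iff.2 fun n => (hae (d n)).ae_eq_mk)
  set N := toMeasurable P {ω | ¬ (ContinuousOn (fun t => B t ω) (Set.Icc (0 : ℝ) T) ∧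
      ∀ n, B (d n) ω = (hae (d n)).mk _ ω)} with hN
  have hNm : MeasurableSet N := measurableSet_toMeasurable _ _
  have hN0 : P N = 0 := by rw [hN, measure_toMeasurable]; exact hgood
  have hNg : ∀ ω, ω ∉ N → ContinuousOn (fun t => B t ω) (Set.Icc (0 : ℝ) T) ∧
      ∀ n, B (d n) ω = (hae (d n)).mk _ ω := fun ω hω => by
    by_contra h
    exact hω (subset_toMeasurable _ _ h)
  -- outside `N` the paths are continuous and determined by countably many measurable variables
  let Y : Set.Icc (0 : ℝ) T → Ω → ℝ := fun s => Nᶜ.indicator (B s)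
  have hYc : ∀ ω, Continuous fun s => Y s ω := by
    intro ω
    by_cases hω : ω ∈ N
    · simpa [Y, hω] using continuous_const
    · have : Continuous fun s : Set.Icc (0 : ℝ) T => B s ω :=
        continuousOn_iff_continuous_domRestrict.1 (hNg ω hω).1
      simpa [Y, hω] using this
  have hYd : ∀ n, Measurable (Y (d n)) := by
    intro n
    have : Y (d n) = Nᶜ.indicator ((hae (d n)).mk _) := by
      ext ω
      by_cases hω : ω ∈ N
      · simp [Y, hω]
      · simp [Y, hω, (hNg ω hω).2 n]
    rw [this]
    exact (hae (d n)).measurable_mk.indicator hNm.compl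
  have hYm : ∀ s, Measurable (Y s) := by
    intro s
    obtain ⟨x, hx, hxs⟩ := mem_closure_iff_seq_limit.1 (hd s)
    choose k hk using hx
    refine measurable_of_tendsto_metrizable (fun n => hYd (k n)) (tendsto_pi_nhds.2 fun ω => ?_)
    simp only [hk]
    exact ((hYc ω).tendsto s).comp hxs
  refine ⟨fun s ω => Y (Set.projIcc 0 T hT s) ω, ?_, ?_⟩
  · have := measurable_uncurry_of_continuous_of_measurable hYc hYm
    exact this.comp
      (((continuous_projIcc (h := hT)).measurable.comp measurable_fst).prodMk measurable_snd)
  · have : ∀ᵐ ω ∂P, ω ∉ N := measure_eq_zero_iff_ae_notMem.1 hN0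
    filter_upwards [this] with ω hω s hs
    simp [Y, hω, Set.projIcc_of_mem hT hs]

theorem IsFractionalBrownianMotion.memLp_two {Ω : Type*} [MeasurableSpace Ω]
    {P : Measure Ω} {H T : ℝ} {B : ℝ → Ω → ℝ} (hB : IsFractionalBrownianMotion P H T B)
    {s : ℝ} (hs : s ∈ Set.Icc (0 : ℝ) T) : MemLp (B s) 2 P :=
  (hB.gaussian.hasGaussianLaw_eval ⟨s, hs⟩).memLp_two

theorem IsFractionalBrownianMotion.integral_sq_sum {Ω : Type*} [MeasurableSpace Ω]
    {P : Measure Ω} {H T : ℝ} {B : ℝ → Ω → ℝ} (hB : IsFractionalBrownianMotion P H T B)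
    {m : ℕ} (s u : Fin m → ℝ) (hs : ∀ j, s j ∈ Set.Icc (0 : ℝ) T) :
    ∫ ω, (∑ j, u j * B (s j) ω) ^ 2 ∂P = fbmVar H s u := by
  have hi : ∀ i j, Integrable (fun ω => u i * u j * (B (s i) ω * B (s j) ω)) P := fun i j =>
    ((hB.memLp_two (hs i)).integrable_mul (hB.memLp_two (hs j))).const_mul _
  have e : ∀ ω, (∑ j, u j * B (s j) ω) ^ 2 = ∑ i, ∑ j, u i * u j * (B (s i) ω * B (s j) ω) := by
    intro ω
    rw [sq, Finset.sum_mul_sum]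
    exact Finset.sum_congr rfl fun i _ => Finset.sum_congr rfl fun j _ => by ring
  simp only [e]
  rw [integral_finsetSum _ fun i _ => integrable_finsetSum _ fun j _ => hi i j, fbmVar]
  refine Finset.sum_congr rfl fun i _ => ?_
  rw [integral_finsetSum _ fun j _ => hi i j]
  refine Finset.sum_congr rfl fun j _ => ?_
  rw [integral_const_mul, hB.covariance _ (hs i) _ (hs j), fbmCov]

/-- The joint characteristic function of a fractional Brownian motion. -/
theorem IsFractionalBrownianMotion.integral_cexp_sum {Ω : Type*} [MeasurableSpace Ω]
    {P : Measure Ω} {H T : ℝ} {B : ℝ → Ω → ℝ} (hB : IsFractionalBrownianMotion P H T B)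
    {m : ℕ} (s u : Fin m → ℝ) (hs : ∀ j, s j ∈ Set.Icc (0 : ℝ) T) :
    ∫ ω, Complex.exp (-(Complex.I * ((∑ j, u j * B (s j) ω : ℝ) : ℂ))) ∂P =
      (Real.exp (-(fbmVar H s u / 2)) : ℂ) := by
  have hG : HasGaussianLaw (fun ω => ∑ j, u j * B (s j) ω) P :=
    ((hB.gaussian.comp_right fun j : Fin m => ⟨s j, hs j⟩).smul u).hasGaussianLaw_fun_sum
      (I := Finset.univ)
  have hmean : ∫ ω, ∑ j, u j * B (s j) ω ∂P = 0 := by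
    have := hB.gaussian.isProbabilityMeasure
    rw [integral_finsetSum _ fun j _ =>
      ((hB.memLp_two (hs j)).integrable (by norm_num)).const_mul _]
    refine Finset.sum_eq_zero fun j _ => ?_
    rw [integral_const_mul, hB.centered _ (hs j), mul_zero]
  have hvar : Var[fun ω => ∑ j, u j * B (s j) ω; P] = fbmVar H s u := by
    rw [variance_of_integral_eq_zero hG.aemeasurable hmean, hB.integral_sq_sum s u hs]
  have hc := congrArg (fun μ => charFun μ (-1)) hG.map_eq_gaussianReal
  simp only [charFun_gaussianReal, hmean, hvar] at hc
  rw [charFun_apply_real, integral_map hG.aemeasurable (by fun_prop)] at hc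
  have hv0 : 0 ≤ fbmVar H s u := hvar ▸ variance_nonneg _ _
  rw [Real.coe_toNNReal _ hv0] at hc
  rw [Complex.ofReal_exp]
  refine Eq.trans ?_ (hc.trans ?_)
  · congr 1
    ext ω
    congr 1
    push_cast
    ring
  · congr 1
    push_cast
    ring

/-! ### Moments of integrals over bounded sets -/

/-- The integrand `f s * i u * exp (-i u (B s - y))` at `z = (u, s)`. -/
noncomputable def lambdaIntegrand {Ω : Type*} (B : ℝ → Ω → ℝ) (f : ℝ → ℝ) (y : ℝ)
    (z : ℝ × ℝ) (ω : Ω) : ℂ :=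
  (f z.2 : ℂ) * (Complex.I * (z.1 : ℂ)) *
    Complex.exp (-(Complex.I * (z.1 : ℂ) * ((B z.2 ω : ℂ) - (y : ℂ))))

theorem norm_cexp_neg_I_mul (x : ℝ) : ‖Complex.exp (-(Complex.I * (x : ℂ)))‖ = 1 := by
  rw [show -(Complex.I * (x : ℂ)) = ((-x : ℝ) : ℂ) * Complex.I by push_cast; ring]
  exact Complex.norm_exp_ofReal_mul_I _

theorem norm_lambdaIntegrand {Ω : Type*} (B' : ℝ → Ω → ℝ) (f : ℝ → ℝ) (y : ℝ) (z : ℝ × ℝ) (ω : Ω) :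
    ‖lambdaIntegrand B' f y z ω‖ = |f z.2| * |z.1| := by
  rw [lambdaIntegrand, norm_mul, norm_mul, norm_mul, Complex.norm_I, one_mul, Complex.norm_real,
    Complex.norm_real, show Complex.I * (z.1 : ℂ) * ((B' z.2 ω : ℂ) - (y : ℂ)) =
      Complex.I * ((z.1 * (B' z.2 ω - y) : ℝ) : ℂ) by push_cast; ring, norm_cexp_neg_I_mul, mul_one,
    Real.norm_eq_abs, Real.norm_eq_abs]

theorem norm_lambdaIntegrand_le {Ω : Type*} {B' : ℝ → Ω → ℝ} {f : ℝ → ℝ} {M : ℝ}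
    (hM : ∀ s, |f s| ≤ M) {R : ℝ} (y : ℝ) {z : ℝ × ℝ}
    (hz : |z.1| ≤ R) (ω : Ω) : ‖lambdaIntegrand B' f y z ω‖ ≤ M * R := by
  rw [norm_lambdaIntegrand]
  exact mul_le_mul (hM _) hz (abs_nonneg _) ((abs_nonneg _).trans (hM 0))

section

variable {Ω : Type*} [MeasurableSpace Ω] {P : Measure Ω} {B B' : ℝ → Ω → ℝ} {f : ℝ → ℝ} {M : ℝ}

theorem measurable_lambdaIntegrand (hB' : Measurable (Function.uncurry B')) (hf : Measurable f)
    (y : ℝ) : Measurable fun p : (ℝ × ℝ) × Ω => lambdaIntegrand B' f y p.1 p.2 := by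
  have h1 : Measurable fun p : (ℝ × ℝ) × Ω => B' p.1.2 p.2 :=
    hB'.comp ((measurable_snd.comp measurable_fst).prodMk measurable_snd)
  have h2 : Measurable fun p : (ℝ × ℝ) × Ω => f p.1.2 :=
    hf.comp (measurable_snd.comp measurable_fst)
  have h3 : Measurable fun p : (ℝ × ℝ) × Ω => p.1.1 := measurable_fst.comp measurable_fst
  unfold lambdaIntegrand
  fun_prop

/-- The mixed moments of the integrand are dominated by the moment kernel. -/
theorem enorm_integral_prod_lambdaIntegrand_le {H T : ℝ} (hB : IsFractionalBrownianMotion P H T B)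
    (hBB' : ∀ᵐ ω ∂P, ∀ s ∈ Set.Icc (0 : ℝ) T, B' s ω = B s ω) (hM : ∀ s, |f s| ≤ M) (y : ℝ)
    {m : ℕ} (z : Fin m → ℝ × ℝ) (hz : ∀ j, (z j).2 ∈ Set.Icc (0 : ℝ) T) :
    ‖∫ ω, ∏ j, lambdaIntegrand B' f y (z j) ω ∂P‖ₑ ≤
      ENNReal.ofReal M ^ m * momentKernel H (fun j => (z j).2) (fun j => (z j).1) := by
  have hM0 : 0 ≤ M := (abs_nonneg _).trans (hM 0)
  have e : (fun ω => ∏ j, lambdaIntegrand B' f y (z j) ω) =ᵐ[P] fun ω =>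
      (∏ j, (f (z j).2 : ℂ) * (Complex.I * ((z j).1 : ℂ)) *
        Complex.exp (-(Complex.I * (((z j).1 * -y : ℝ) : ℂ)))) *
      Complex.exp (-(Complex.I * ((∑ j, (z j).1 * B (z j).2 ω : ℝ) : ℂ))) := by
    filter_upwards [hBB'] with ω hω
    rw [Complex.ofReal_sum, Finset.mul_sum, ← Finset.sum_neg_distrib, Complex.exp_sum,
      ← Finset.prod_mul_distrib]
    refine Finset.prod_congr rfl fun j _ => ?_
    rw [lambdaIntegrand, hω _ (hz j), mul_assoc _ (Complex.exp _) (Complex.exp _),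
      ← Complex.exp_add]
    congr 2
    push_cast
    ring
  rw [integral_congr_ae e, integral_const_mul, hB.integral_cexp_sum _ _ hz, enorm_mul,
    ← ofReal_norm, ← ofReal_norm, ← ENNReal.ofReal_mul (norm_nonneg _), momentKernel,
    ← ENNReal.ofReal_pow hM0, ← ENNReal.ofReal_mul (by positivity)]
  refine ENNReal.ofReal_le_ofReal ?_
  rw [norm_prod, Complex.norm_real, Real.norm_eq_abs, Real.abs_exp, ← mul_assoc]
  refine mul_le_mul_of_nonneg_right ?_ (Real.exp_pos _).le
  rw [show M ^ m = ∏ _j : Fin m, M by simp, ← Finset.prod_mul_distrib]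
  refine Finset.prod_le_prod (fun j _ => norm_nonneg _) fun j _ => ?_
  rw [norm_mul, norm_mul, norm_mul, norm_cexp_neg_I_mul, Complex.norm_I, one_mul, mul_one,
    Complex.norm_real, Complex.norm_real, Real.norm_eq_abs, Real.norm_eq_abs]
  exact mul_le_mul_of_nonneg_right (hM _) (abs_nonneg _)

/-- **Moment bound.** The `m`-th moment of a real-valued integral of the integrand over a bounded
set `S` is an `m`-fold integral over `S ^ m`, by Fubini's theorem. -/
theorem lintegral_pow_enorm_setIntegral_le [IsProbabilityMeasure P] {H T : ℝ}
    (hB : IsFractionalBrownianMotion P H T B) (hB' : Measurable (Function.uncurry B'))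
    (hBB' : ∀ᵐ ω ∂P, ∀ s ∈ Set.Icc (0 : ℝ) T, B' s ω = B s ω) (hf : Measurable f)
    (hM : ∀ s, |f s| ≤ M) (y : ℝ) {m : ℕ} (hm : Even m) {S : Set (ℝ × ℝ)} (hS : MeasurableSet S)
    {R : ℝ} (hSR : S ⊆ Set.Icc (-R) R ×ˢ Set.Icc 0 T)
    (hreal : ∀ᵐ ω ∂P, (∫ z in S, lambdaIntegrand B' f y z ω).im = 0) :
    ∫⁻ ω, ‖∫ z in S, lambdaIntegrand B' f y z ω‖ₑ ^ m ∂P ≤ ENNReal.ofReal M ^ m *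
      ∫⁻ z in Set.univ.pi fun _ : Fin m => S,
        momentKernel H (fun j => (z j).2) (fun j => (z j).1) := by
  set Z : Ω → ℂ := fun ω => ∫ z in S, lambdaIntegrand B' f y z ω with hZ
  have hmeas := measurable_lambdaIntegrand hB' hf y
  have hSfin : volume S < ∞ := (measure_mono hSR).trans_lt
    (isCompact_Icc.prod isCompact_Icc).measure_lt_top
  have : IsFiniteMeasure (volume.restrict S) := ⟨by simpa using hSfin⟩
  have hbd : ∀ ω, ∀ z ∈ S, ‖lambdaIntegrand B' f y z ω‖ ≤ M * R := fun ω z hz =>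
    norm_lambdaIntegrand_le hM y (abs_le.2 (hSR hz).1) ω
  -- the integrand of the `m`-fold integral
  set G : Ω → (Fin m → ℝ × ℝ) → ℂ := fun ω z => ∏ j, lambdaIntegrand B' f y (z j) ω with hG
  have hpow : ∀ ω, Z ω ^ m = ∫ z, G ω z ∂(Measure.pi fun _ : Fin m => volume.restrict S) := by
    intro ω
    have := integral_fintype_prod_eq_pow (ι := Fin m) (μ := volume.restrict S)
      (fun z => lambdaIntegrand B' f y z ω)
    rw [hZ, hG, this, Fintype.card_fin]
  have hGm : Measurable (Function.uncurry G) := by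
    refine Finset.measurable_prod _ fun j _ => ?_
    have : Measurable fun p : Ω × (Fin m → ℝ × ℝ) => (p.2 j, p.1) := by fun_prop
    exact hmeas.comp this
  have hpi : (Measure.pi fun _ : Fin m => (volume.restrict S : Measure (ℝ × ℝ))) =
      volume.restrict (Set.univ.pi fun _ : Fin m => S) := by
    rw [volume_pi, Measure.restrict_pi_pi]
  have hGi : Integrable (Function.uncurry G)
      (P.prod (Measure.pi fun _ : Fin m => volume.restrict S)) := by
    refine Integrable.of_bound hGm.aestronglyMeasurable ((M * R) ^ m) ?_
    have h1 : ∀ᵐ z ∂(Measure.pi fun _ : Fin m => (volume.restrict S : Measure (ℝ × ℝ))),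
        ∀ j, z j ∈ S := by
      rw [hpi]
      filter_upwards [ae_restrict_mem (MeasurableSet.univ_pi fun _ => hS)] with z hz j
      exact hz j trivial
    have h2 := Measure.quasiMeasurePreserving_snd (μ := P)
      (ν := Measure.pi fun _ : Fin m => (volume.restrict S : Measure (ℝ × ℝ))) |>.ae h1
    filter_upwards [h2] with p hp
    rw [Function.uncurry_def, hG, norm_prod, show (M * R) ^ m = ∏ _j : Fin m, M * R by simp]
    exact Finset.prod_le_prod (fun j _ => norm_nonneg _) fun j _ => hbd _ _ (hp j)
  have hZi : Integrable (fun ω => Z ω ^ m) P := by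
    simp only [hpow]
    exact hGi.integral_prod_left
  -- an even power of a real number is nonnegative, so the absolute value can be dropped
  have habs : ∫⁻ ω, ‖Z ω‖ₑ ^ m ∂P = ‖∫ ω, Z ω ^ m ∂P‖ₑ := by
    have e : (fun ω => Z ω ^ m) =ᵐ[P] fun ω => ((‖Z ω‖ ^ m : ℝ) : ℂ) := by
      filter_upwards [hreal] with ω hω
      have hω : Z ω = ((Z ω).re : ℂ) := Complex.ext (by simp) (by simpa using hω)
      rw [hω, Complex.norm_real, Real.norm_eq_abs, hm.pow_abs, Complex.ofReal_pow]
    have hi : Integrable (fun ω => ‖Z ω‖ ^ m) P := by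
      have := hZi.norm
      simpa only [norm_pow] using this
    rw [integral_congr_ae e, integral_complex_ofReal, ← ofReal_norm, Complex.norm_real,
      Real.norm_eq_abs, abs_of_nonneg (integral_nonneg fun ω => by positivity),
      ofReal_integral_eq_lintegral_ofReal hi (Eventually.of_forall fun ω => by positivity)]
    refine lintegral_congr fun ω => ?_
    rw [ENNReal.ofReal_pow (norm_nonneg _), ofReal_norm]
  rw [habs]
  simp only [hpow]
  rw [integral_integral_swap hGi]
  refine (enorm_integral_le_lintegral_enorm _).trans ?_
  rw [hpi, ← lintegral_const_mul' _ _ (by finiteness)]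
  refine setLIntegral_mono' (MeasurableSet.univ_pi fun _ => hS) fun z hz => ?_
  exact enorm_integral_prod_lambdaIntegrand_le hB hBB' hM y z fun j => (hSR (hz j trivial)).2

end

/-! ### Integrating the moment kernel -/

theorem measurable_momentKernel (H : ℝ) (m : ℕ) :
    Measurable fun p : (Fin m → ℝ) × (Fin m → ℝ) => momentKernel H p.1 p.2 := by
  unfold momentKernel fbmVar fbmCov
  have : ∀ i : Fin m, Measurable fun p : (Fin m → ℝ) × (Fin m → ℝ) => p.1 i := fun i => by fun_prop
  have : ∀ i : Fin m, Measurable fun p : (Fin m → ℝ) × (Fin m → ℝ) => p.2 i := fun i => by fun_prop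
  fun_prop

theorem momentKernel_comp_perm (H : ℝ) {m : ℕ} (σ : Equiv.Perm (Fin m)) (s u : Fin m → ℝ) :
    momentKernel H (s ∘ σ) (u ∘ σ) = momentKernel H s u := by
  have h1 : ∏ j, |(u ∘ σ) j| = ∏ j, |u j| := Equiv.prod_comp σ fun j => |u j|
  have h2 : fbmVar H (s ∘ σ) (u ∘ σ) = fbmVar H s u := by
    unfold fbmVar
    rw [← Equiv.sum_comp σ fun i => ∑ j, u i * u j * fbmCov H (s i) (s j)]
    refine Finset.sum_congr rfl fun i _ => ?_
    exact Equiv.sum_comp σ fun j => u (σ i) * u j * fbmCov H (s (σ i)) (s j)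
  rw [momentKernel, momentKernel, h1, h2]

theorem lintegral_momentKernel_comp_perm (H : ℝ) {m : ℕ} (s : Fin m → ℝ)
    (σ : Equiv.Perm (Fin m)) :
    ∫⁻ u, momentKernel H (s ∘ σ) u = ∫⁻ u, momentKernel H s u := by
  have mp := volume_measurePreserving_piCongrLeft (fun _ : Fin m => ℝ) σ.symm
  rw [← mp.lintegral_comp_emb (MeasurableEquiv.measurableEmbedding _)]
  simp only [piCongrLeft_perm_symm, momentKernel_comp_perm]

/-- The constant of the moment estimate: the constant of the frequency integral times the factors
`Γ (1 - 3 * H)` and `T ^ (1 - 3 * H)` contributed by each variable of the Dirichlet integral. -/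
noncomputable def lambdaConst (H T : ℝ) : ℝ :=
  8 * √Real.pi * T ^ H / (1 - 2 * H) * Real.Gamma (1 - 3 * H) * T ^ (1 - 3 * H)

theorem lambdaConst_pos {H T : ℝ} (hH : H < 1 / 3) (hT : 0 < T) : 0 < lambdaConst H T := by
  have h1 : 0 < 1 - 2 * H := by linarith
  have h2 : 0 < Real.Gamma (1 - 3 * H) := Real.Gamma_pos_of_pos (by linarith)
  have := Real.pi_pos
  unfold lambdaConst
  positivity

/-- The integral of the moment kernel over all times in `(0, T)` and all frequencies. -/
theorem setLIntegral_momentKernel_le {Ω : Type*} [MeasurableSpace Ω] {P : Measure Ω}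
    {B : ℝ → Ω → ℝ} {H T : ℝ} (hH0 : 0 < H) (hH : H < 1 / 3) (hT : 0 < T)
    (hB : IsFractionalBrownianMotion P H T B) (m : ℕ) :
    ∫⁻ z in Set.univ.pi fun _ : Fin m => (Set.univ : Set ℝ) ×ˢ Set.Ioo 0 T,
        momentKernel H (fun j => (z j).2) (fun j => (z j).1) ≤
      ENNReal.ofReal (lambdaConst H T ^ m * (m ! : ℝ) / Real.Gamma (m * (1 - 3 * H) + 1)) := by
  set Q : Set (Fin m → ℝ) := {s | ∀ j, s j ∈ Set.Ioo 0 T} with hQ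
  have hker := measurable_momentKernel H m
  have mp := volume_measurePreserving_arrowProdEquivProdArrow ℝ ℝ (Fin m)
  have hsplit : ∫⁻ z in Set.univ.pi fun _ : Fin m => (Set.univ : Set ℝ) ×ˢ Set.Ioo 0 T,
        momentKernel H (fun j => (z j).2) (fun j => (z j).1) =
      ∫⁻ s in Q, ∫⁻ u, momentKernel H s u := by
    have h1 := mp.setLIntegral_comp_preimage_emb (MeasurableEquiv.measurableEmbedding _)
      (fun p => momentKernel H p.2 p.1) (Set.univ ×ˢ Q)
    have h2 : (MeasurableEquiv.arrowProdEquivProdArrow ℝ ℝ (Fin m)) ⁻¹' (Set.univ ×ˢ Q) =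
        Set.univ.pi fun _ : Fin m => (Set.univ : Set ℝ) ×ˢ Set.Ioo 0 T := by
      ext z
      simp [hQ, Set.mem_pi, MeasurableEquiv.arrowProdEquivProdArrow,
        Equiv.arrowProdEquivProdArrow]
    rw [h2] at h1
    refine h1.trans ?_
    have hswap : Measurable fun p : (Fin m → ℝ) × (Fin m → ℝ) => momentKernel H p.2 p.1 :=
      hker.comp measurable_swap
    rw [Measure.volume_eq_prod, ← Measure.prod_restrict, Measure.restrict_univ,
      lintegral_prod_symm _ hswap.aemeasurable]
  set C₀ : ℝ := 8 * √Real.pi * T ^ H / (1 - 2 * H) with hC₀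
  have hC₀p : 0 < C₀ := by
    have h1 : 0 < 1 - 2 * H := by linarith
    have := Real.pi_pos
    rw [hC₀]; positivity
  have hsimplex : ∀ s ∈ openSimplex 0 T m, ∫⁻ u, momentKernel H s u ≤
      ENNReal.ofReal C₀ ^ m * ∏ j, ENNReal.ofReal (gap 0 s j ^ ((1 - 3 * H) - 1)) := by
    intro s hs
    have hmem : ∀ j, MemLp (B (s j)) 2 P := fun j =>
      hB.memLp_two (Set.Ioo_subset_Icc_self (hs.2 j))
    refine (lintegral_momentKernel_le hH0 (by linarith) hT s hs.1 (fun j => (hs.2 j).1)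
      (fun j => (hs.2 j).2.le) (fun j => (hmem j).toLp) fun i j => ?_).trans (le_of_eq ?_)
    · rw [MeasureTheory.L2.inner_def, fbmCov,
        ← hB.covariance _ (Set.Ioo_subset_Icc_self (hs.2 i)) _ (Set.Ioo_subset_Icc_self (hs.2 j))]
      refine integral_congr_ae ?_
      filter_upwards [(hmem i).coeFn_toLp, (hmem j).coeFn_toLp] with ω h1 h2
      rw [h1, h2]
      simp [mul_comm]
    · simp only [← hC₀, ENNReal.ofReal_mul hC₀p.le]
      rw [Finset.prod_mul_distrib]
      simp [show 1 - 3 * H - 1 = -(3 * H) by ring]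
  have hG : 0 < Real.Gamma (m * (1 - 3 * H) + 1) := Real.Gamma_pos_of_pos (by
    have : 0 < 1 - 3 * H := by linarith
    positivity)
  have hG1 : 0 < Real.Gamma (1 - 3 * H) := Real.Gamma_pos_of_pos (by linarith)
  rw [hsplit]
  calc ∫⁻ s in Q, ∫⁻ u, momentKernel H s u
      ≤ (m ! : ℝ≥0∞) * ∫⁻ s in openSimplex 0 T m, ∫⁻ u, momentKernel H s u :=
        lintegral_cube_le_factorial_mul_openSimplex _
          fun s σ => lintegral_momentKernel_comp_perm H s σ
    _ ≤ (m ! : ℝ≥0∞) * ∫⁻ s in openSimplex 0 T m,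
          ENNReal.ofReal C₀ ^ m * ∏ j, ENNReal.ofReal (gap 0 s j ^ ((1 - 3 * H) - 1)) :=
        mul_le_mul_right (setLIntegral_mono' (measurableSet_openSimplex _ _ _) hsimplex) _
    _ = _ := by
        rw [lintegral_const_mul' _ _ (by finiteness),
          setLIntegral_openSimplex_prod_gap (by linarith) T m 0 hT, ← ENNReal.ofReal_pow hC₀p.le,
          ← ENNReal.ofReal_natCast, ← ENNReal.ofReal_mul (by positivity),
          ← ENNReal.ofReal_mul (by positivity), lambdaConst, ← hC₀, mul_pow, mul_pow, sub_zero,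
          mul_comm (m : ℝ), Real.rpow_mul hT.le, Real.rpow_natCast]
        congr 1
        ring

/-- The integral of the moment kernel over times in `(0, T)` and frequencies outside `(-K, K]`. -/
noncomputable def tailKernelIntegral (H T : ℝ) (m : ℕ) (K : ℝ) : ℝ≥0∞ :=
  ∫⁻ z in Set.univ.pi fun _ : Fin m => (Set.Ioc (-K) K)ᶜ ×ˢ Set.Ioo 0 T,
    momentKernel H (fun j => (z j).2) (fun j => (z j).1)

theorem tendsto_tailKernelIntegral {H T : ℝ} {m : ℕ} (hm : m ≠ 0)
    (hfin : ∫⁻ z in Set.univ.pi fun _ : Fin m => (Set.univ : Set ℝ) ×ˢ Set.Ioo 0 T,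
        momentKernel H (fun j => (z j).2) (fun j => (z j).1) ≠ ∞) :
    Tendsto (tailKernelIntegral H T m) atTop (𝓝 0) := by
  have hk : Measurable fun z : Fin m → ℝ × ℝ =>
      momentKernel H (fun j => (z j).2) (fun j => (z j).1) :=
    (measurable_momentKernel H m).comp (f := fun z : Fin m → ℝ × ℝ =>
      ((fun j => (z j).2), fun j => (z j).1)) (by fun_prop)
  have hS : ∀ K : ℝ, MeasurableSet
      (Set.univ.pi fun _ : Fin m => (Set.Ioc (-K) K)ᶜ ×ˢ Set.Ioo 0 T) := fun K =>
    MeasurableSet.univ_pi fun _ => measurableSet_Ioc.compl.prod measurableSet_Ioo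
  have hS' : MeasurableSet
      (Set.univ.pi fun _ : Fin m => (Set.univ : Set ℝ) ×ˢ Set.Ioo 0 T) :=
    MeasurableSet.univ_pi fun _ => MeasurableSet.univ.prod measurableSet_Ioo
  unfold tailKernelIntegral
  simp only [← lintegral_indicator (hS _)]
  rw [← lintegral_zero (μ := (volume : Measure (Fin m → ℝ × ℝ)))]
  refine tendsto_lintegral_filter_of_dominated_convergence
    ((Set.univ.pi fun _ : Fin m => (Set.univ : Set ℝ) ×ˢ Set.Ioo 0 T).indicator
      fun z => momentKernel H (fun j => (z j).2) (fun j => (z j).1))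
    (Eventually.of_forall fun K => hk.indicator (hS K))
    (Eventually.of_forall fun K => Eventually.of_forall fun z => ?_)
    (by rwa [lintegral_indicator hS']) (Eventually.of_forall fun z => ?_)
  · refine Set.indicator_le_indicator_of_subset (Set.pi_mono fun j _ => ?_) (fun _ => zero_le) _
    exact Set.prod_mono (Set.subset_univ _) le_rfl
  · have j : Fin m := ⟨0, Nat.pos_of_ne_zero hm⟩
    refine tendsto_const_nhds.congr' ?_
    filter_upwards [eventually_gt_atTop |(z j).1|] with K hK
    rw [Set.indicator_of_notMem]
    intro hz
    exact (hz j trivial).1 ⟨(abs_lt.1 hK).1, (abs_lt.1 hK).2.le⟩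

/-! ### Truncated variables and their limit -/

theorem integrableOn_lambdaIntegrand {Ω : Type*} [MeasurableSpace Ω] {B' : ℝ → Ω → ℝ} {f : ℝ → ℝ}
    {M : ℝ} (hB' : Measurable (Function.uncurry B')) (hf : Measurable f) (hM : ∀ s, |f s| ≤ M)
    (y : ℝ) {S : Set (ℝ × ℝ)} {R t : ℝ} (hSR : S ⊆ Set.Icc (-R) R ×ˢ Set.Icc 0 t) (ω : Ω) :
    IntegrableOn (fun z => lambdaIntegrand B' f y z ω) S := by
  have hm : Measurable fun z : ℝ × ℝ => lambdaIntegrand B' f y z ω :=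
    (measurable_lambdaIntegrand hB' hf y).comp (measurable_id.prodMk measurable_const)
  refine IntegrableOn.mono_set ?_ hSR
  refine Measure.integrableOn_of_bounded (M := M * R)
    (isCompact_Icc.prod isCompact_Icc).measure_lt_top.ne hm.aestronglyMeasurable ?_
  filter_upwards [ae_restrict_mem (measurableSet_Icc.prod measurableSet_Icc)] with z hz
  exact norm_lambdaIntegrand_le hM y (abs_le.2 hz.1) ω

/-- The truncated variable is a double integral over `(-K, K] × (0, t)`. -/
theorem truncLambda_eq_setIntegral {Ω : Type*} [MeasurableSpace Ω] {B B' : ℝ → Ω → ℝ}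
    {b : ℝ → ℝ → ℝ} {f : ℝ → ℝ} {M t y K : ℝ} (hB' : Measurable (Function.uncurry B'))
    (hf : Measurable f) (hM : ∀ s, |f s| ≤ M) (ht : 0 ≤ t) (hK : 0 ≤ K) {ω : Ω}
    (hBω : ∀ s ∈ Set.Icc 0 t, B' s ω = B s ω) (hfb : ∀ s ∈ Set.Icc 0 t, f s = b s y) :
    truncLambda B b t y K ω = (2 * (Real.pi : ℂ))⁻¹ *
      ∫ z in Set.Ioc (-K) K ×ˢ Set.Ioo 0 t, lambdaIntegrand B' f y z ω := by
  have hi := integrableOn_lambdaIntegrand hB' hf hM y (R := K) (t := t)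
    (Set.prod_mono Set.Ioc_subset_Icc_self Set.Ioo_subset_Icc_self) ω
  rw [truncLambda, intervalIntegral.integral_of_le (by linarith), Measure.volume_eq_prod,
    setIntegral_prod _ hi]
  congr 1
  refine integral_congr_ae (Eventually.of_forall fun u => ?_)
  simp only
  rw [intervalIntegral.integral_of_le ht, integral_Ioc_eq_integral_Ioo]
  refine setIntegral_congr_fun measurableSet_Ioo fun s hs => ?_
  have hs' := Set.Ioo_subset_Icc_self hs
  simp only [lambdaIntegrand, hBω s hs', hfb s hs']

/-- The truncated variables are real: conjugation amounts to the substitution `u ↦ -u`. -/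
theorem truncLambda_im {Ω : Type*} (B : ℝ → Ω → ℝ) (b : ℝ → ℝ → ℝ) (t y K : ℝ) (ω : Ω) :
    (truncLambda B b t y K ω).im = 0 := by
  rw [← Complex.conj_eq_iff_im, truncLambda, map_mul, ← intervalIntegral.intervalIntegral_conj]
  congr 1
  · simp [map_ofNat]
  rw [← neg_neg K, neg_neg (-K), ← intervalIntegral.integral_comp_neg, neg_neg]
  refine intervalIntegral.integral_congr fun u _ => ?_
  rw [← intervalIntegral.intervalIntegral_conj]
  refine intervalIntegral.integral_congr fun s _ => ?_
  simp [← Complex.exp_conj]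

theorem truncLambda_neg {Ω : Type*} (B : ℝ → Ω → ℝ) (b : ℝ → ℝ → ℝ) (t y K : ℝ) (ω : Ω) :
    truncLambda B b t y (-K) ω = -truncLambda B b t y K ω := by
  rw [truncLambda, truncLambda, neg_neg, intervalIntegral.integral_symm, mul_neg]

/-- A family that is Cauchy in every `L^m`, `m ≥ 2` even, with rate `ε m` has a common limit, and
the limit inherits the rate by Fatou's lemma. -/
theorem exists_limit_of_eLpNorm_sub_le {Ω : Type*} [MeasurableSpace Ω] {P : Measure Ω}
    {E : Type*} [NormedAddCommGroup E] [CompleteSpace E] [MeasurableSpace E] [BorelSpace E]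
    [SecondCountableTopology E] {X : ℝ → Ω → E} (hX : ∀ K, AEStronglyMeasurable (X K) P)
    {ε : ℕ → ℝ → ℝ≥0∞} (hε : Tendsto (ε 2) atTop (𝓝 0))
    (hXε : ∀ m : ℕ, Even m → m ≠ 0 → ∀ K K', 0 ≤ K → K ≤ K' →
      eLpNorm (X K' - X K) m P ≤ ε m K) :
    ∃ L : Ω → E, AEStronglyMeasurable L P ∧
      ∀ m : ℕ, Even m → m ≠ 0 → ∀ K, 0 ≤ K → eLpNorm (X K - L) m P ≤ ε m K := by
  have hev : ∀ N : ℕ, ∃ k : ℕ, ∀ j ≥ k, ε 2 j < 2⁻¹ ^ N := fun N => by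
    have h1 := (hε.comp tendsto_natCast_atTop_atTop).eventually
      (gt_mem_nhds (show (0 : ℝ≥0∞) < 2⁻¹ ^ N from ENNReal.pow_pos (by simp) N))
    exact eventually_atTop.1 h1
  -- along a fast subsequence the variables converge almost surely
  obtain ⟨κ, hκ, hκε⟩ := extraction_forall_of_eventually' hev
  have hcau : ∀ᵐ ω ∂P, ∃ l, Tendsto (fun n => X (κ n) ω) atTop (𝓝 l) := by
    refine Lp.ae_tendsto_of_cauchy_eLpNorm (p := 2) (fun n => hX _) (by norm_num)
      (B := fun N => 2⁻¹ ^ N) (by simp) fun N n k hn hk => ?_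
    have hmono : ∀ n k : ℕ, N ≤ n → n ≤ k →
        eLpNorm (X (κ k) - X (κ n)) 2 P < 2⁻¹ ^ N := by
      intro n k hn hnk
      have h1 := hXε 2 even_two two_ne_zero (κ n) (κ k) (Nat.cast_nonneg _)
        (Nat.cast_le.2 (hκ.monotone hnk))
      refine (by exact_mod_cast h1 : eLpNorm (X (κ k) - X (κ n)) 2 P ≤ ε 2 (κ n)).trans_lt ?_
      exact (hκε n).trans_le (pow_le_pow_right_of_le_one' (by simp) hn)
    rcases le_total n k with h | h
    · rw [eLpNorm_sub_comm]
      exact hmono n k hn h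
    · exact hmono k n hk h
  obtain ⟨L, hLm, hL⟩ := exists_stronglyMeasurable_limit_of_tendsto_ae (fun n => hX (κ n)) hcau
  refine ⟨L, hLm.aestronglyMeasurable, fun m hm hm0 K hK => ?_⟩
  have hfat := Lp.eLpNorm_lim_le_liminf_eLpNorm (p := (m : ℝ≥0∞)) (μ := P)
    (f := fun n => X K - X (κ n)) (fun n => (hX K).sub (hX _)) (X K - L) (by
      filter_upwards [hL] with ω hω
      exact tendsto_const_nhds.sub hω)
  refine hfat.trans (liminf_le_of_frequently_le' (Eventually.frequently ?_))
  have : Tendsto (fun n => (κ n : ℝ)) atTop atTop :=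
    tendsto_natCast_atTop_atTop.comp hκ.tendsto_atTop
  filter_upwards [this.eventually_ge_atTop K] with n hn
  rw [eLpNorm_sub_comm]
  exact hXε m hm hm0 K _ hK hn

/-! ### The moment estimate -/

theorem eLpNorm_natCast_eq {Ω : Type*} [MeasurableSpace Ω] {P : Measure Ω} {E : Type*}
    [NormedAddCommGroup E] (X : Ω → E) {m : ℕ} (hm : m ≠ 0) :
    eLpNorm X m P = (∫⁻ ω, ‖X ω‖ₑ ^ m ∂P) ^ (1 / (m : ℝ)) := by
  rw [eLpNorm_eq_lintegral_rpow_enorm_toReal (by exact_mod_cast hm) (by simp)]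
  simp

/-- The difference of two truncated variables is an integral over frequencies outside
`(-K, K]`, so its moments are bounded by the tail of the moment kernel. -/
theorem eLpNorm_truncLambda_sub_le {Ω : Type*} [MeasurableSpace Ω] {P : Measure Ω}
    [IsProbabilityMeasure P] {B B' : ℝ → Ω → ℝ} {H T : ℝ}
    (hB : IsFractionalBrownianMotion P H T B) (hB' : Measurable (Function.uncurry B'))
    (hBB' : ∀ᵐ ω ∂P, ∀ s ∈ Set.Icc (0 : ℝ) T, B' s ω = B s ω) {b : ℝ → ℝ → ℝ} {f : ℝ → ℝ}
    {M t y : ℝ} (hf : Measurable f) (hM : ∀ s, |f s| ≤ M) (ht : t ∈ Set.Icc 0 T)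
    (hfb : ∀ s ∈ Set.Icc 0 t, f s = b s y) {m : ℕ} (hm : Even m) (hm0 : m ≠ 0) {K K' : ℝ}
    (hK : 0 ≤ K) (hKK' : K ≤ K') :
    eLpNorm (fun ω => truncLambda B b t y K' ω - truncLambda B b t y K ω) m P ≤
      (ENNReal.ofReal M ^ m * tailKernelIntegral H T m K) ^ (1 / (m : ℝ)) := by
  set A : Set (ℝ × ℝ) := Set.Ioc (-K) K ×ˢ Set.Ioo 0 t with hA
  set A' : Set (ℝ × ℝ) := Set.Ioc (-K') K' ×ˢ Set.Ioo 0 t with hA'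
  have hAA' : A ⊆ A' := Set.prod_mono (Set.Ioc_subset_Ioc (by linarith) hKK') le_rfl
  have hAm : MeasurableSet A := measurableSet_Ioc.prod measurableSet_Ioo
  have hAm' : MeasurableSet A' := measurableSet_Ioc.prod measurableSet_Ioo
  have hA't : A' ⊆ Set.Icc (-K') K' ×ˢ Set.Icc 0 t :=
    Set.prod_mono Set.Ioc_subset_Icc_self Set.Ioo_subset_Icc_self
  have hdiff : ∀ᵐ ω ∂P, truncLambda B b t y K' ω - truncLambda B b t y K ω =
      (2 * (Real.pi : ℂ))⁻¹ * ∫ z in A' \ A, lambdaIntegrand B' f y z ω := by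
    filter_upwards [hBB'] with ω hω
    have hω' : ∀ s ∈ Set.Icc 0 t, B' s ω = B s ω := fun s hs => hω s ⟨hs.1, hs.2.trans ht.2⟩
    rw [truncLambda_eq_setIntegral hB' hf hM ht.1 hK hω' hfb,
      truncLambda_eq_setIntegral hB' hf hM ht.1 (hK.trans hKK') hω' hfb, ← mul_sub,
      setIntegral_sdiff hAm (integrableOn_lambdaIntegrand hB' hf hM y hA't ω) hAA']
  have hreal : ∀ᵐ ω ∂P, (∫ z in A' \ A, lambdaIntegrand B' f y z ω).im = 0 := by
    filter_upwards [hdiff] with ω hω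
    have h1 : (∫ z in A' \ A, lambdaIntegrand B' f y z ω) = ((2 * Real.pi : ℝ) : ℂ) *
        (truncLambda B b t y K' ω - truncLambda B b t y K ω) := by
      rw [hω]
      have := Real.pi_ne_zero
      push_cast
      field_simp
    rw [h1, Complex.im_ofReal_mul]
    simp [truncLambda_im]
  have hmain := lintegral_pow_enorm_setIntegral_le hB hB' hBB' hf hM y hm (hAm'.diff hAm)
    (R := K') ((Set.sdiff_subset.trans hA't).trans
      (Set.prod_mono le_rfl (Set.Icc_subset_Icc_right ht.2))) hreal
  rw [eLpNorm_natCast_eq _ hm0]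
  refine ENNReal.rpow_le_rpow ?_ (by positivity)
  calc ∫⁻ ω, ‖truncLambda B b t y K' ω - truncLambda B b t y K ω‖ₑ ^ m ∂P
      ≤ ∫⁻ ω, ‖∫ z in A' \ A, lambdaIntegrand B' f y z ω‖ₑ ^ m ∂P := by
        refine lintegral_mono_ae ?_
        filter_upwards [hdiff] with ω hω
        rw [hω, enorm_mul]
        refine pow_le_pow_left' ?_ m
        have h2 : ‖(2 * (Real.pi : ℂ))⁻¹‖ₑ ≤ 1 := by
          rw [← ofReal_norm, ENNReal.ofReal_le_one, norm_inv, norm_mul, Complex.norm_real,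
            Real.norm_of_nonneg Real.pi_pos.le]
          refine inv_le_one_of_one_le₀ ?_
          simp only [Complex.norm_ofNat]
          linarith [Real.pi_gt_three]
        exact mul_le_of_le_one_left' h2
    _ ≤ _ := hmain
    _ ≤ _ := by
        refine mul_le_mul_right (lintegral_mono_set (Set.pi_mono fun j _ => ?_)) _
        rintro z ⟨hz', hz⟩
        exact ⟨fun h => hz ⟨h, hz'.2⟩, hz'.2.1, hz'.2.2.trans_le ht.2⟩

theorem memLp_truncLambda {Ω : Type*} [MeasurableSpace Ω] {P : Measure Ω}
    [IsProbabilityMeasure P] {B B' : ℝ → Ω → ℝ} {T : ℝ} (hB' : Measurable (Function.uncurry B'))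
    (hBB' : ∀ᵐ ω ∂P, ∀ s ∈ Set.Icc (0 : ℝ) T, B' s ω = B s ω) {b : ℝ → ℝ → ℝ} {f : ℝ → ℝ}
    {M t y : ℝ} (hf : Measurable f) (hM : ∀ s, |f s| ≤ M) (ht : t ∈ Set.Icc 0 T)
    (hfb : ∀ s ∈ Set.Icc 0 t, f s = b s y) (p : ℝ≥0∞) (K : ℝ) :
    MemLp (truncLambda B b t y K) p P := by
  have hpos : ∀ K : ℝ, 0 ≤ K → MemLp (truncLambda B b t y K) p P := by
    intro K hK
    set A : Set (ℝ × ℝ) := Set.Ioc (-K) K ×ˢ Set.Ioo 0 t with hA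
    have hAt : A ⊆ Set.Icc (-K) K ×ˢ Set.Icc 0 t :=
      Set.prod_mono Set.Ioc_subset_Icc_self Set.Ioo_subset_Icc_self
    have he : (fun ω => (2 * (Real.pi : ℂ))⁻¹ * ∫ z in A, lambdaIntegrand B' f y z ω) =ᵐ[P]
        truncLambda B b t y K := by
      filter_upwards [hBB'] with ω hω
      exact (truncLambda_eq_setIntegral hB' hf hM ht.1 hK
        (fun s hs => hω s ⟨hs.1, hs.2.trans ht.2⟩) hfb).symm
    refine MemLp.ae_eq he (MemLp.const_mul (MemLp.of_bound ?_ (M * K * volume.real A)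
      (Eventually.of_forall fun ω => ?_)) _)
    · exact ((measurable_lambdaIntegrand hB' hf y).stronglyMeasurable.integral_prod_left
        (μ := volume.restrict A)).aestronglyMeasurable
    · exact norm_setIntegral_le_of_norm_le_const ((measure_mono hAt).trans_lt
        (isCompact_Icc.prod isCompact_Icc).measure_lt_top) fun z hz =>
          norm_lambdaIntegrand_le hM y (abs_le.2 (hAt hz).1) ω
  rcases le_total 0 K with hK | hK
  · exact hpos K hK
  · have h := (hpos (-K) (by linarith)).neg
    refine MemLp.ae_eq (Eventually.of_forall fun ω => ?_) h
    simp [truncLambda_neg]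

theorem mainTheorem5 (H T : ℝ) (hH0 : 0 < H) (hH : H < 1 / 3) (hT : 0 < T) :
    ∃ C : ℝ, 0 < C ∧
      ∀ (Ω : Type*) [MeasurableSpace Ω] (P : Measure Ω) [IsProbabilityMeasure P]
        (B : ℝ → Ω → ℝ), IsFractionalBrownianMotion P H T B →
      ∀ b : ℝ → ℝ → ℝ, Measurable (fun p : Set.Icc (0 : ℝ) T × ℝ => b p.1 p.2) →
        (∃ M : ℝ, ∀ s ∈ Set.Icc (0 : ℝ) T, ∀ y : ℝ, |b s y| ≤ M) →
      ∀ t ∈ Set.Icc (0 : ℝ) T, ∀ y : ℝ,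
        ∃ L : Ω → ℝ, IsLambda P B b t y L ∧
          (∀ L' : Ω → ℝ, IsLambda P B b t y L' → L' =ᵐ[P] L) ∧
          ∀ m : ℕ, Even m →
            ∫ ω, |L ω| ^ m ∂P ≤
              C ^ m * driftSupNorm T b ^ m * (m ! : ℝ) / Real.Gamma (m * (1 - 3 * H) + 1) := by
  refine ⟨lambdaConst H T, lambdaConst_pos hH hT, ?_⟩
  intro Ω _ P _ B hB b hb ⟨M₀, hM₀⟩ t ht y
  obtain ⟨B', hB', hBB'⟩ := hB.exists_measurable_modification hT.le
  set M : ℝ := driftSupNorm T b with hMdef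
  -- `b (·, y)` is measurable and bounded on `[0, T]` only; it is extended by constants
  set f : ℝ → ℝ := fun s => b (Set.projIcc 0 T hT.le s) y with hfdef
  have hf : Measurable f :=
    hb.comp ((continuous_projIcc (h := hT.le)).measurable.prodMk measurable_const)
  have hM : ∀ s, |f s| ≤ M := fun s =>
    le_ciSup (f := fun p : Set.Icc (0 : ℝ) T × ℝ => |b p.1 p.2|)
      ⟨M₀, by rintro _ ⟨p, rfl⟩; exact hM₀ _ p.1.2 _⟩ (Set.projIcc 0 T hT.le s, y)
  have hM0 : 0 ≤ M := (abs_nonneg _).trans (hM 0)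
  have hfb : ∀ s ∈ Set.Icc 0 t, f s = b s y := fun s hs => by
    simp only [hfdef, Set.projIcc_of_mem hT.le ⟨hs.1, hs.2.trans ht.2⟩]
  -- the truncated variables, as real random variables
  set X : ℝ → Ω → ℝ := fun K ω => (truncLambda B b t y K ω).re with hXdef
  have hXC : ∀ K ω, truncLambda B b t y K ω = (X K ω : ℂ) := fun K ω =>
    Complex.ext (by simp [hXdef]) (by simp [truncLambda_im])
  have hmem : ∀ (p : ℝ≥0∞) K, MemLp (truncLambda B b t y K) p P :=
    memLp_truncLambda hB' hBB' hf hM ht hfb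
  have hXmem : ∀ (p : ℝ≥0∞) K, MemLp (X K) p P := fun p K => (hmem p K).re
  have hX0 : X 0 = 0 := by
    ext ω
    simp [hXdef, truncLambda]
  set ε : ℕ → ℝ → ℝ≥0∞ := fun m K =>
    (ENNReal.ofReal M ^ m * tailKernelIntegral H T m K) ^ (1 / (m : ℝ)) with hεdef
  have htot := setLIntegral_momentKernel_le hH0 hH hT hB
  have hε : ∀ m : ℕ, m ≠ 0 → Tendsto (ε m) atTop (𝓝 0) := fun m hm => by
    have h1 := tendsto_tailKernelIntegral hm ((htot m).trans_lt ENNReal.ofReal_lt_top).ne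
    have h2 := ENNReal.Tendsto.const_mul (a := ENNReal.ofReal M ^ m) h1 (Or.inr (by finiteness))
    have hm' : (0 : ℝ) < 1 / m := by positivity
    have h3 := (ENNReal.continuous_rpow_const (y := 1 / (m : ℝ))).tendsto _ |>.comp h2
    rwa [mul_zero, ENNReal.zero_rpow_of_pos hm'] at h3
  obtain ⟨L, hLm, hL⟩ := exists_limit_of_eLpNorm_sub_le (X := X) (fun K => (hXmem 0 K).1)
    (hε 2 two_ne_zero) (fun m hm hm0 K K' hK hKK' => by
      refine le_trans (le_of_eq (eLpNorm_congr_norm_ae (Eventually.of_forall fun ω => ?_)))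
        (eLpNorm_truncLambda_sub_le hB hB' hBB' hf hM ht hfb hm hm0 hK hKK')
      rw [hXC, hXC, ← Complex.ofReal_sub, Complex.norm_real, Pi.sub_apply])
  have hLC : ∀ K (p : ℝ≥0∞), eLpNorm (fun ω => truncLambda B b t y K ω - (L ω : ℂ)) p P =
      eLpNorm (X K - L) p P := fun K p => by
    refine eLpNorm_congr_norm_ae (Eventually.of_forall fun ω => ?_)
    rw [hXC, ← Complex.ofReal_sub, Complex.norm_real, Pi.sub_apply]
  have hLp : ∀ p : ℝ≥0, ∃ m : ℕ, m ≠ 0 ∧ ∀ K, 0 ≤ K → eLpNorm (X K - L) p P ≤ ε m K := by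
    intro p
    refine ⟨2 * (⌈p⌉₊ + 1), by omega, fun K hK => ?_⟩
    refine le_trans (eLpNorm_le_eLpNorm_of_exponent_le ?_ ((hXmem 0 K).1.sub hLm))
      (hL (2 * (⌈p⌉₊ + 1)) (even_two_mul _) (by omega) K hK)
    have h1 : p ≤ ((2 * (⌈p⌉₊ + 1) : ℕ) : ℝ≥0) :=
      (Nat.le_ceil p).trans (Nat.cast_le.2 (by omega))
    exact_mod_cast h1
  have htend : ∀ p : ℝ≥0, Tendsto (fun K => eLpNorm (X K - L) p P) atTop (𝓝 0) := by
    intro p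
    obtain ⟨m, hm, h⟩ := hLp p
    refine tendsto_of_tendsto_of_tendsto_of_le_of_le' tendsto_const_nhds (hε m hm)
      (Eventually.of_forall fun _ => zero_le) ?_
    filter_upwards [eventually_ge_atTop 0] with K hK using h K hK
  have hLmem : ∀ p : ℝ≥0, MemLp L p P := by
    intro p
    obtain ⟨K, hK⟩ := ((htend p).eventually (gt_mem_nhds zero_lt_one)).exists
    have h1 : MemLp (X K - L) p P := ⟨(hXmem 0 K).1.sub hLm, hK.trans ENNReal.one_lt_top⟩
    simpa using (hXmem p K).sub h1
  refine ⟨L, ⟨fun p K => hmem p K, hLmem, fun p => by simpa only [hLC] using htend p⟩, ?_, ?_⟩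
  · intro L' hL'
    have h1 := hL'.tendsto 1
    have h2 := htend 1
    have h3 : ∀ K, eLpNorm (L' - L) 1 P ≤
        eLpNorm (fun ω => truncLambda B b t y K ω - (L' ω : ℂ)) 1 P + eLpNorm (X K - L) 1 P := by
      intro K
      have e : eLpNorm (fun ω => truncLambda B b t y K ω - (L' ω : ℂ)) 1 P =
          eLpNorm (X K - L') 1 P := by
        refine eLpNorm_congr_norm_ae (Eventually.of_forall fun ω => ?_)
        rw [hXC, ← Complex.ofReal_sub, Complex.norm_real, Pi.sub_apply]
      have hL'm : AEStronglyMeasurable L' P := (hL'.memLp 0).1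
      rw [e, eLpNorm_sub_comm (X K) L', show L' - L = (L' - X K) + (X K - L) by abel]
      exact eLpNorm_add_le (hL'm.sub (hXmem 0 K).1) ((hXmem 0 K).1.sub hLm) le_rfl
    have h4 : eLpNorm (L' - L) 1 P ≤ 0 := by
      have h6 := h1.add h2
      rw [add_zero] at h6
      exact ge_of_tendsto' h6 h3
    have h5 := (eLpNorm_eq_zero_iff ((hL'.memLp 0).1.sub hLm) one_ne_zero).1 (le_zero_iff.1 h4)
    filter_upwards [h5] with ω hω
    simpa [sub_eq_zero] using hω
  · intro m hm
    rcases eq_or_ne m 0 with rfl | hm0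
    · simp
    -- the truncation at `K = 0` vanishes, so the rate at `K = 0` bounds the limit itself
    have hLε := hL m hm hm0 0 le_rfl
    rw [hX0, zero_sub, eLpNorm_neg, eLpNorm_natCast_eq _ hm0, hεdef,
      ENNReal.rpow_le_rpow_iff (by positivity)] at hLε
    have hG : 0 < Real.Gamma (m * (1 - 3 * H) + 1) := Real.Gamma_pos_of_pos (by
      have : 0 < 1 - 3 * H := by linarith
      positivity)
    have hC := (lambdaConst_pos hH hT).le
    have hb1 : ∫⁻ ω, ‖L ω‖ₑ ^ m ∂P ≤ ENNReal.ofReal (lambdaConst H T ^ m * M ^ m * (m ! : ℝ) /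
        Real.Gamma (m * (1 - 3 * H) + 1)) := by
      refine hLε.trans ((mul_le_mul_right ((lintegral_mono_set (Set.pi_mono fun j _ =>
        Set.prod_mono (Set.subset_univ _) le_rfl)).trans (htot m)) _).trans (le_of_eq ?_))
      rw [← ENNReal.ofReal_pow hM0, ← ENNReal.ofReal_mul (by positivity)]
      congr 1
      ring
    have hLabs : AEStronglyMeasurable (fun ω => |L ω| ^ m) P :=
      ((continuous_abs.pow m).comp_aestronglyMeasurable hLm)
    rw [integral_eq_lintegral_of_nonneg_ae
      (Eventually.of_forall fun ω => pow_nonneg (abs_nonneg _) m) hLabs]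
    refine ENNReal.toReal_le_of_le_ofReal (by positivity) (le_trans (le_of_eq ?_) hb1)
    refine lintegral_congr fun ω => ?_
    rw [ENNReal.ofReal_pow (abs_nonneg _), ← Real.norm_eq_abs, ofReal_norm]
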